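/- Let $1\le p<\infty$. Let $(X,d,\mathfrak m)$ be a doubling metric measure space: $(X,d)$ is a separable metric space, not necessarily complete, and $\mathfrak m$ is a nontrivial Radon measure, finite on bounded sets, such that $\mathfrak m(B_{2r}(x))\le C_D\,\mathfrak m(B_r(x))$ for all $x\in X$, $r>0$, for some constant $C_D\ge 1$. Fix $x,y\in X$. Notation. For $L\ge 1$ put $B^L_{x,y}=B_{L d(x,y)}(x)\cup B_{L d(x,y)}(y)$ and let $\mathfrak m^L_{x,y}=R^L_{x,y}\,\mathfrak m$, where $R^L_{x,y}(x)=R^L_{x,y}(y)=0$ and $$R^L_{x,y}(z)=\left(\frac{d(x,z)}{\mathfrak m(B_{d(x,z)}(x))}+\frac{d(y,z)}{\mathfrak m(B_{d(y,z)}(y))}\right)\chi_{B^L_{x,y}}(z)\qquad (z\neq x,y).$$ For $u\colon X\to\mathbb R$ let $\mathrm{lip}\,u(z)=\lim_{\varepsilon\to0}\sup_{w\in B_\varepsilon(z)\setminus\{z\}}\frac{|u(w)-u(z)|}{d(w,z)}$ (the supremum of the empty set being $0$). For $\varepsilon>0$ an $\varepsilon$-chain is a finite sequence $c=\{q_i\}_{i=0}^N$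 of points of $X$ with $d(q_i,q_{i+1})\le\varepsilon$ for all $i$; its length is $\ell(c)=\sum_{i<N}d(q_i,q_{i+1})$, and for $g\colon X\to[0,\infty]$ (with $\infty\cdot 0=0$) $$\int_c g=\sum_{i=0}^{N-1}\frac{g(q_i)+g(q_{i+1})}{2}\,d(q_i,q_{i+1}).$$ A Borel function $g\colon X\to[0,\infty]$ is an $\varepsilon$-upper gradient of $u$ if $|u(q_N)-u(q_0)|\le\int_c g$ for every $\varepsilon$-chain $c=\{q_i\}_{i=0}^N$; it is an upper gradient of $u$ if $|u(\gamma(b))-u(\gamma(a))|\le\int_\gamma g$ for every rectifiable curve $\gamma\colon[a,b]\to X$, where $\int_\gamma g$ is the integral with respect to arc length. For constants $C>0$, $L\ge1$ consider the following conditions. (i) For every Lipschitz $u\colon X\to\mathbb R$, $$|u(x)-u(y)|^p\le C\,d(x,y)^{p-1}\int(\mathrm{lip}\,u)^p\,d\mathfrak m^L_{x,y}.$$ (ii) For every Borel $g\colon X\to[0,\infty]$ with $g(x),g(y)<\infty$, $$\lim_{\varepsilon\to0}\ \inf\left\{\Big(\int_c g\Big)^p : c\text{ an }\varepsilon\text{-chain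 from }x\text{ to }y,\ \ell(c)\le C\,d(x,y)\right\}\le C\,d(x,y)^{p-1}\int g^p\,d\mathfrak m^L_{x,y},$$ where $\inf\emptyset=\infty$. (iii) For every Borel $u\colon X\to\mathbb R$, every $\varepsilon>0$ and every $\varepsilon$-upper gradient $g$ of $u$ with $g(x),g(y)<\infty$, $$|u(x)-u(y)|^p\le C\,d(x,y)^{p-1}\int g^p\,d\mathfrak m^L_{x,y}.$$ (iv) For every Borel $u\colon X\to\mathbb R$ and every Borel upper gradient $g$ of $u$, $$|u(x)-u(y)|^p\le C\,d(x,y)^{p-1}\int g^p\,d\mathfrak m^L_{x,y}.$$ Then (i), (ii) and (iii) are quantitatively equivalent: given $p$, $C_D$, $C>0$ and $L\ge1$ there are constants $C'>0$ and $L'\ge1$, depending only on $p,C_D,C,L$ (and not on the space, the measure or the points $x,y$), such that if one of (i), (ii), (iii) holds with constants $C,L$ then all of them hold with constants $C',L'$. If moreover $(X,d)$ is complete, then the same is true of the four conditions (i), (ii), (iii), (iv); no local quasiconvexity of $X$ is assumed. -/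

import Mathlib

open Set Filter Topology MeasureTheory
open scoped ENNReal

noncomputable section

namespace ChainPI

/-- `(X, d, μ)` is a doubling metric measure space with doubling constant `CD`: the measure `μ` is
a nontrivial Radon measure, finite on bounded sets, and doubling on (open) balls. The metric space
itself is not assumed to be complete. -/
structure IsDoublingMetricMeasureSpace {X : Type*} [MetricSpace X] [MeasurableSpace X]
    [BorelSpace X] (μ : Measure X) (CD : ℝ) : Prop where
  radon : μ.Regular
  nontrivial : μ ≠ 0
  finite_on_bounded : ∀ s : Set X, Bornology.IsBounded s → μ s < ∞
  doubling : ∀ (x : X) (r : ℝ), 0 < r →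
    μ (Metric.ball x (2 * r)) ≤ ENNReal.ofReal CD * μ (Metric.ball x r)

/-- The slope of `u` at scale `ε`:
`sup_{z ∈ B_ε(x)} |u z - u x| / d(z, x)`; the point `z = x` contributes `0 / 0 = 0`. -/
def slope {X : Type*} [MetricSpace X] (ε : ℝ) (u : X → ℝ) (x : X) : ℝ≥0∞ :=
  ⨆ z ∈ Metric.ball x ε, edist (u z) (u x) / edist z x

/-- The local Lipschitz constant `lip u (x) = lim_{ε → 0} slope ε u x = inf_{ε > 0} slope ε u x`. -/
def localLip {X : Type*} [MetricSpace X] (u : X → ℝ) (x : X) : ℝ≥0∞ :=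
  ⨅ (ε : ℝ) (_ : 0 < ε), slope ε u x

/-- `B_{x,y}^L`, the union of the balls of radius `L d(x,y)` centred at `x` and at `y`. -/
def doubleBall {X : Type*} [MetricSpace X] (L : ℝ) (x y : X) : Set X :=
  Metric.ball x (L * dist x y) ∪ Metric.ball y (L * dist x y)

open Classical in
/-- The `L`-truncated Riesz potential with poles at `x` and `y`, set to be `0` at the poles. -/
def rieszKernel {X : Type*} [MetricSpace X] [MeasurableSpace X] (μ : Measure X) (L : ℝ)
    (x y z : X) : ℝ≥0∞ :=
  if z ∈ doubleBall L x y ∧ z ≠ x ∧ z ≠ y then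
    edist x z / μ (Metric.ball x (dist x z)) + edist y z / μ (Metric.ball y (dist y z))
  else 0

/-- The measure `μ_{x,y}^L`, with density the truncated Riesz potential. -/
def rieszMeasure {X : Type*} [MetricSpace X] [MeasurableSpace X] (μ : Measure X) (L : ℝ)
    (x y : X) : Measure X :=
  μ.withDensity (rieszKernel μ L x y)

/-- The energy `C d(x,y)^{p-1} ∫ g^p dμ_{x,y}^L`, the right-hand side of all the estimates. -/
def rieszEnergy {X : Type*} [MetricSpace X] [MeasurableSpace X] (μ : Measure X) (p C L : ℝ)
    (x y : X) (g : X → ℝ≥0∞) : ℝ≥0∞ :=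
  ENNReal.ofReal C * edist x y ^ (p - 1) * ∫⁻ z, g z ^ p ∂(rieszMeasure μ L x y)

/-- A chain: a finite sequence of points `q_0, …, q_N`. -/
structure PointChain (X : Type*) where
  N : ℕ
  pt : Fin (N + 1) → X

namespace PointChain

variable {X : Type*}

/-- The starting point `q_0`. -/
def first (c : PointChain X) : X := c.pt 0

/-- The final point `q_N`. -/
def last (c : PointChain X) : X := c.pt (Fin.last c.N)

/-- `c` is an `ε`-chain: consecutive points are at distance at most `ε`. -/
def IsEpsChain [MetricSpace X] (c : PointChain X) (ε : ℝ) : Prop :=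
  ∀ i : Fin c.N, dist (c.pt i.castSucc) (c.pt i.succ) ≤ ε

/-- `∫_c g = ∑_{i < N} (g(q_i) + g(q_{i+1})) / 2 * d(q_i, q_{i+1})`, with `∞ * 0 = 0`. -/
def integral [MetricSpace X] (c : PointChain X) (g : X → ℝ≥0∞) : ℝ≥0∞ :=
  ∑ i : Fin c.N,
    (g (c.pt i.castSucc) + g (c.pt i.succ)) / 2 * edist (c.pt i.castSucc) (c.pt i.succ)

/-- The length `ℓ(c) = ∑_{i < N} d(q_i, q_{i+1})` of a chain. -/
def length [MetricSpace X] (c : PointChain X) : ℝ≥0∞ :=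
  ∑ i : Fin c.N, edist (c.pt i.castSucc) (c.pt i.succ)

end PointChain

/-- `g` is an `ε`-upper gradient of `u`. -/
def IsEpsUpperGradient {X : Type*} [MetricSpace X] [MeasurableSpace X] (ε : ℝ) (u : X → ℝ)
    (g : X → ℝ≥0∞) : Prop :=
  Measurable g ∧
    ∀ c : PointChain X, c.IsEpsChain ε → edist (u c.last) (u c.first) ≤ c.integral g

/-- The restriction of `γ` to `[a, b]` is a rectifiable curve. -/
def IsRectifiableCurve {X : Type*} [MetricSpace X] (γ : ℝ → X) (a b : ℝ) : Prop :=
  a < b ∧ ContinuousOn γ (Icc a b) ∧ eVariationOn γ (Icc a b) ≠ ∞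

/-- The integral of `g` over the rectifiable curve `γ` on `[a, b]`, that is the integral of `g`
along the arc-length reparametrization of `γ`, defined on `[0, ℓ(γ)]`. -/
def curveIntegral {X : Type*} [MetricSpace X] (g : X → ℝ≥0∞) (γ : ℝ → X) (a b : ℝ) : ℝ≥0∞ :=
  ∫⁻ t in Icc 0 (eVariationOn γ (Icc a b)).toReal, g (naturalParameterization γ (Icc a b) a t)

/-- `g` is a (Borel) upper gradient of `u`, along rectifiable curves. -/
def IsUpperGradient {X : Type*} [MetricSpace X] [MeasurableSpace X] (u : X → ℝ)
    (g : X → ℝ≥0∞) : Prop :=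
  Measurable g ∧ ∀ (γ : ℝ → X) (a b : ℝ), IsRectifiableCurve γ a b →
    edist (u (γ b)) (u (γ a)) ≤ curveIntegral g γ a b

/-- The pointwise estimate at `x, y` for all couples `(u, lip u)` with `u` Lipschitz. -/
def LipEstimate {X : Type*} [MetricSpace X] [MeasurableSpace X] (μ : Measure X) (p : ℝ)
    (x y : X) (C L : ℝ) : Prop :=
  ∀ u : X → ℝ, (∃ K, LipschitzWith K u) →
    edist (u x) (u y) ^ p ≤ rieszEnergy μ p C L x y (localLip u)

/-- The infimum of `(∫_c g)^p` over the `ε`-chains `c` from `x` to `y` with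
`ℓ(c) ≤ C d(x,y)`. -/
def chainInf {X : Type*} [MetricSpace X] (p C : ℝ) (x y : X) (g : X → ℝ≥0∞) (ε : ℝ) : ℝ≥0∞ :=
  ⨅ (c : PointChain X) (_ : c.IsEpsChain ε ∧ c.first = x ∧ c.last = y ∧
    c.length ≤ ENNReal.ofReal C * edist x y), c.integral g ^ p

/-- Existence of short `ε`-chains from `x` to `y`, as `ε → 0`, along which the integral of `g` is
controlled by the energy of `g`, for every Borel `g` that is finite at `x` and `y`. -/
def ChainConnectivity {X : Type*} [MetricSpace X] [MeasurableSpace X] (μ : Measure X) (p : ℝ)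
    (x y : X) (C L : ℝ) : Prop :=
  ∀ g : X → ℝ≥0∞, Measurable g → g x < ∞ → g y < ∞ →
    ∃ l : ℝ≥0∞, Tendsto (chainInf p C x y g) (𝓝[>] 0) (𝓝 l) ∧ l ≤ rieszEnergy μ p C L x y g

/-- The pointwise estimate at `x, y` for all couples `(u, g)` with `u` Borel and `g` an
`ε`-upper gradient of `u`, for some `ε > 0`, that is finite at `x` and `y`. -/
def EpsUpperGradientEstimate {X : Type*} [MetricSpace X] [MeasurableSpace X] (μ : Measure X)
    (p : ℝ) (x y : X) (C L : ℝ) : Prop :=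
  ∀ u : X → ℝ, Measurable u → ∀ ε : ℝ, 0 < ε → ∀ g : X → ℝ≥0∞, IsEpsUpperGradient ε u g →
    g x < ∞ → g y < ∞ → edist (u x) (u y) ^ p ≤ rieszEnergy μ p C L x y g

/-- The pointwise estimate at `x, y` for all couples `(u, g)` with `u` Borel and `g` an upper
gradient of `u` along curves. -/
def UpperGradientEstimate {X : Type*} [MetricSpace X] [MeasurableSpace X] (μ : Measure X)
    (p : ℝ) (x y : X) (C L : ℝ) : Prop :=
  ∀ u : X → ℝ, Measurable u → ∀ g : X → ℝ≥0∞, IsUpperGradient u g →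
    edist (u x) (u y) ^ p ≤ rieszEnergy μ p C L x y g

end ChainPI

end

/-! `LipEstimate` is the hub. `ChainConnectivity` gives `EpsUpperGradientEstimate` because an upper
gradient along chains bounds the increment of `u` by every fine chain integral. That in turn gives
`LipEstimate`: the slope of `u` at a fixed scale is an upper gradient along finer chains, it
decreases to `localLip u`, and dominated convergence applies because the Riesz measure is finite.

To get chains from `LipEstimate`, test it with the truncated chain distance from `x` for a cost `G`;
its local Lipschitz constant is at most a local upper bound of `G`
(`LipEstimate.chainCostInf_rpow_le`). For a merely Borel `f` the choice `G = f` is useless, so `G`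
is built from averages of `f ^ p` over balls of radius `min (ε, d(z,x), d(z,y)) / 16`. On such
Whitney balls the Riesz kernel is almost constant, so by Tonelli averaging costs only a constant and
a doubling of `L` (`lintegral_ballAverage_le`). The result is a very fine chain that is cheap for
`G`. `ChainCost.exists_coarse` trades it for an `ε`-chain through nearby points where `f` is at most
its average; the pieces near the poles are negligible because the poles are null for the Riesz
measure. Applied to `f = g + l`, with `l` slightly above an `L^p` mean of `g`, the same chain has
controlled length.

In a complete space, `UpperGradientEstimate` implies `LipEstimate` since `localLip u` is an upper
gradient of a Lipschitz `u`. Conversely, replace `g` by a lower semicontinuous majorant with almost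
the same energy (Vitali–Carathéodory), and exhaust it from below by Lipschitz functions. The chain
distance now needs no averaging. It yields chains of vanishing mesh and bounded length, which
converge to a Lipschitz curve because a complete doubling space is proper, and the integral bound
passes to the limit (`exists_curve_of_chainCost`). The curves are produced by the estimate itself,
so no quasiconvexity is needed. -/

namespace ChainPI

/-! ### Chains: concatenation, integrals, and costs of chains. -/

section Chains

variable {X : Type*}

/-- `ChainCost ε G x z t` says that some `ε`-chain from `x` to `z` has `G`-integral `t`. -/
inductive ChainCost [MetricSpace X] (ε : ℝ) (G : X → ℝ≥0∞) (x : X) : X → ℝ≥0∞ → Prop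
  | refl : ChainCost ε G x x 0
  | step {z w : X} {t : ℝ≥0∞} : ChainCost ε G x z t → dist z w ≤ ε →
      ChainCost ε G x w (t + (G z + G w) / 2 * edist z w)

/-- The chain consisting of one point. -/
def PointChain.single (x : X) : PointChain X := ⟨0, fun _ => x⟩

/-- Appending a point to a chain. -/
def PointChain.snoc (c : PointChain X) (w : X) : PointChain X :=
  ⟨c.N + 1, Fin.snoc (α := fun _ => X) c.pt w⟩

namespace PointChain

variable (c : PointChain X) (w : X)

lemma snoc_pt_castSucc (i : Fin (c.N + 1)) : (c.snoc w).pt i.castSucc = c.pt i :=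
  Fin.snoc_castSucc (α := fun _ => X) w c.pt i

lemma snoc_pt_last : (c.snoc w).pt (Fin.last (c.N + 1)) = w :=
  Fin.snoc_last (α := fun _ => X) w c.pt

lemma snoc_first : (c.snoc w).first = c.first := c.snoc_pt_castSucc w 0

lemma snoc_last : (c.snoc w).last = w := c.snoc_pt_last w

lemma snoc_pt_succ_castSucc (i : Fin c.N) :
    (c.snoc w).pt (i.castSucc.succ) = c.pt i.succ := by
  rw [← c.snoc_pt_castSucc w i.succ]; rfl

lemma snoc_pt_succ_last : (c.snoc w).pt ((Fin.last c.N).succ) = w := c.snoc_pt_last w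

lemma edist_last_first_le {Y : Type*} [PseudoEMetricSpace Y] 
    (u : X → Y) :
    edist (u c.last) (u c.first) ≤
      ∑ i : Fin c.N, edist (u (c.pt i.castSucc)) (u (c.pt i.succ)) := by
  obtain ⟨N, q⟩ := c
  have h := edist_le_range_sum_edist (fun n => u (q (Fin.ofNat (N + 1) n))) N
  rw [Finset.sum_range] at h
  rw [edist_comm]
  convert h using 1
  · simp [PointChain.first, PointChain.last]
  · refine Finset.sum_congr rfl fun i _ => ?_
    congr 3
    · ext; simp [Fin.ofNat, Nat.mod_eq_of_lt (Nat.lt_succ_of_lt i.2)]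
    · ext; simp [Fin.ofNat, Nat.mod_eq_of_lt (Nat.succ_lt_succ i.2)]

variable [MetricSpace X]

lemma snoc_integral (g : X → ℝ≥0∞) :
    (c.snoc w).integral g = c.integral g + (g c.last + g w) / 2 * edist c.last w := by
  unfold integral
  refine (Fin.sum_univ_castSucc (n := c.N) _).trans ?_
  refine congrArg₂ (· + ·) (Finset.sum_congr rfl fun i _ => ?_) ?_
  · exact congrArg₂ (fun a b => (g a + g b) / 2 * edist a b)
      (c.snoc_pt_castSucc w i.castSucc) (c.snoc_pt_succ_castSucc w i)
  · exact congrArg₂ (fun a b => (g a + g b) / 2 * edist a b)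
      (c.snoc_pt_castSucc w (Fin.last c.N)) (c.snoc_pt_succ_last w)

lemma snoc_isEpsChain {ε : ℝ} (hc : c.IsEpsChain ε) (h : dist c.last w ≤ ε) :
    (c.snoc w).IsEpsChain ε := by
  intro i
  refine Fin.lastCases ?_ (fun j => ?_) i
  · exact (congrArg₂ dist (c.snoc_pt_castSucc w (Fin.last c.N)) (c.snoc_pt_succ_last w)).le.trans h
  · exact (congrArg₂ dist (c.snoc_pt_castSucc w j.castSucc)
      (c.snoc_pt_succ_castSucc w j)).le.trans (hc j)

lemma single_integral (x : X) (g : X → ℝ≥0∞) : (single x).integral g = 0 :=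
  Fin.sum_univ_zero _

lemma single_length (x : X) : (single x).length = 0 :=
  Fin.sum_univ_zero _

lemma integral_mono {g h : X → ℝ≥0∞} (hgh : ∀ z, g z ≤ h z) : c.integral g ≤ c.integral h := by
  unfold integral
  gcongr <;> exact hgh _

lemma integral_const (a : ℝ≥0∞) : c.integral (fun _ => a) = a * c.length := by
  unfold integral length
  rw [Finset.mul_sum]
  refine Finset.sum_congr rfl fun i _ => ?_
  congr 1
  rw [ENNReal.add_div, ENNReal.add_halves]

end PointChain

variable [MetricSpace X]

lemma ChainCost.exists_pointChain {ε : ℝ} {G : X → ℝ≥0∞} {x z : X} {t : ℝ≥0∞}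
    (h : ChainCost ε G x z t) :
    ∃ c : PointChain X, c.IsEpsChain ε ∧ c.first = x ∧ c.last = z ∧ c.integral G = t := by
  induction h with
  | refl =>
    exact ⟨PointChain.single x, fun i => i.elim0, rfl, rfl,
      PointChain.single_integral x G⟩
  | @step z w t _ hd ih =>
    obtain ⟨c, h1, h2, h3, h4⟩ := ih
    refine ⟨c.snoc w, c.snoc_isEpsChain w h1 (by rw [h3]; exact hd), by rw [c.snoc_first, h2],
      c.snoc_last w, ?_⟩
    rw [c.snoc_integral, h3, h4]

end Chains

/-! ### Slopes at a fixed scale and the local Lipschitz constant. -/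

section Slope

variable {X : Type*} [MetricSpace X]

lemma edist_le_slope_mul {ε : ℝ} (u : X → ℝ) {z w : X} (h : dist z w < ε) :
    edist (u z) (u w) ≤ slope ε u w * edist z w := by
  rcases eq_or_ne z w with rfl | hne
  · simp
  have h1 : edist (u z) (u w) / edist z w ≤ slope ε u w :=
    le_iSup₂_of_le z (Metric.mem_ball.2 h) le_rfl
  rwa [ENNReal.div_le_iff (by simpa [edist_eq_zero] using hne) (edist_ne_top _ _)] at h1

lemma slope_le_of_lipschitz {ε : ℝ} {u : X → ℝ} {K : NNReal} (hu : LipschitzWith K u) (x : X) :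
    slope ε u x ≤ K := by
  refine iSup₂_le fun z _ => ENNReal.div_le_of_le_mul (hu z x)

lemma slope_mono {ε ε' : ℝ} (h : ε ≤ ε') (u : X → ℝ) (x : X) : slope ε u x ≤ slope ε' u x :=
  biSup_mono fun _ hz => Metric.ball_subset_ball h hz

lemma localLip_le_slope {ε : ℝ} (hε : 0 < ε) (u : X → ℝ) (x : X) : localLip u x ≤ slope ε u x :=
  iInf₂_le ε hε

lemma lowerSemicontinuous_slope {ε : ℝ} {u : X → ℝ} (hu : Continuous u) :
    LowerSemicontinuous (slope ε u) := by
  intro x a ha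
  obtain ⟨z, hz⟩ := lt_iSup_iff.1 ha
  obtain ⟨hzb, hz⟩ := lt_iSup_iff.1 hz
  -- At `z = x` the quotient is `0 / 0 = 0`, which exceeds no `a`; for `z ≠ x` it is continuous in
  -- the centre.
  have hne : z ≠ x := by
    rintro rfl
    simp at hz
  have hc : ContinuousAt (fun y => edist (u z) (u y) / edist z y) x := by
    refine ENNReal.Tendsto.div ?_ (Or.inr ?_) ?_ (Or.inl (edist_ne_top _ _))
    · exact (continuous_const.edist hu).continuousAt
    · simpa [edist_eq_zero] using hne
    · exact (continuous_const.edist continuous_id).continuousAt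
  have h1 : ∀ᶠ y in 𝓝 x, z ∈ Metric.ball y ε := by
    have : Metric.ball z ε ∈ 𝓝 x := Metric.isOpen_ball.mem_nhds (Metric.mem_ball_comm.1 hzb)
    filter_upwards [this] with y hy using Metric.mem_ball_comm.1 hy
  filter_upwards [h1, hc.eventually (lt_mem_nhds hz)] with y hy1 hy2
  exact hy2.trans_le (le_iSup₂_of_le z hy1 le_rfl)

lemma localLip_eq_iInf_nat (u : X → ℝ) (x : X) :
    localLip u x = ⨅ n : ℕ, slope (1 / ((n : ℝ) + 1)) u x := by
  refine le_antisymm (le_iInf fun n => localLip_le_slope (by positivity) u x) ?_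
  refine le_iInf₂ fun ε hε => ?_
  obtain ⟨n, hn⟩ := exists_nat_one_div_lt hε
  exact iInf_le_of_le n (slope_mono hn.le u x)

lemma antitone_slope_nat (u : X → ℝ) (x : X) :
    Antitone fun n : ℕ => slope (1 / ((n : ℝ) + 1)) u x := by
  intro m n hmn
  apply slope_mono
  gcongr

lemma tendsto_slope_localLip (u : X → ℝ) (x : X) :
    Tendsto (fun n : ℕ => slope (1 / ((n : ℝ) + 1)) u x) atTop (𝓝 (localLip u x)) := by
  rw [localLip_eq_iInf_nat]
  exact tendsto_atTop_iInf (antitone_slope_nat u x)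

lemma measurable_localLip [MeasurableSpace X] [BorelSpace X] {u : X → ℝ} (hu : Continuous u) :
    Measurable (localLip u) := by
  have : localLip u = fun x => ⨅ n : ℕ, slope (1 / ((n : ℝ) + 1)) u x :=
    funext (localLip_eq_iInf_nat u)
  rw [this]
  exact .iInf fun n => (lowerSemicontinuous_slope hu).measurable

/-- Each step of a chain is bounded by the slope at either of its endpoints, hence by the mean of
the two. The gap `ε' < ε` is there because chains allow steps equal to `ε'` while the slope uses
open balls. -/
lemma isEpsUpperGradient_slope [MeasurableSpace X] [BorelSpace X] {u : X → ℝ} (hu : Continuous u)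
    {ε ε' : ℝ} (h : ε' < ε) : IsEpsUpperGradient ε' u (slope ε u) := by
  refine ⟨(lowerSemicontinuous_slope hu).measurable, fun c hc => ?_⟩
  refine (c.edist_last_first_le u).trans ?_
  unfold PointChain.integral
  refine Finset.sum_le_sum fun i _ => ?_
  have h1 := edist_le_slope_mul (ε := ε) u ((hc i).trans_lt h)
  have h2 : edist (u (c.pt i.castSucc)) (u (c.pt i.succ)) ≤
      slope ε u (c.pt i.castSucc) * edist (c.pt i.castSucc) (c.pt i.succ) := by
    rw [edist_comm, edist_comm (c.pt i.castSucc)]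
    exact edist_le_slope_mul u (by rw [dist_comm]; exact (hc i).trans_lt h)
  set a := edist (u (c.pt i.castSucc)) (u (c.pt i.succ))
  set d := edist (c.pt i.castSucc) (c.pt i.succ)
  calc a = (a + a) / 2 := by rw [ENNReal.add_div, ENNReal.add_halves]
    _ ≤ (slope ε u (c.pt i.castSucc) * d + slope ε u (c.pt i.succ) * d) / 2 := by gcongr
    _ = _ := by rw [← add_mul, div_eq_mul_inv, div_eq_mul_inv]; ring

lemma chainInf_antitone (p C : ℝ) (x y : X) (g : X → ℝ≥0∞) : Antitone (chainInf p C x y g) := by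
  intro ε ε' h
  unfold chainInf
  exact biInf_mono fun c hc => ⟨fun i => (hc.1 i).trans h, hc.2⟩

end Slope

/-! ### Monotonicity in the constants, and from chains to upper gradients along chains. -/

section Easy

variable {X : Type*} [MetricSpace X] [MeasurableSpace X]

lemma rieszKernel_mono (μ : Measure X) {L L' : ℝ} (h : L ≤ L') (x y z : X) :
    rieszKernel μ L x y z ≤ rieszKernel μ L' x y z := by
  unfold rieszKernel
  split_ifs with h1 h2
  · exact le_rfl
  · refine absurd ⟨?_, h1.2⟩ h2
    have : L * dist x y ≤ L' * dist x y := by gcongr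
    exact h1.1.imp (fun h => Metric.ball_subset_ball this h)
      (fun h => Metric.ball_subset_ball this h)
  · exact zero_le
  · exact le_rfl

lemma rieszMeasure_mono (μ : Measure X) {L L' : ℝ} (h : L ≤ L') (x y : X) :
    rieszMeasure μ L x y ≤ rieszMeasure μ L' x y :=
  withDensity_mono (ae_of_all _ (rieszKernel_mono μ h x y))

lemma rieszEnergy_mono (μ : Measure X) (p : ℝ) {C C' L L' : ℝ} (hC : C ≤ C') (hL : L ≤ L')
    (x y : X) (g : X → ℝ≥0∞) : rieszEnergy μ p C L x y g ≤ rieszEnergy μ p C' L' x y g := by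
  unfold rieszEnergy
  gcongr
  exact rieszMeasure_mono μ hL x y

lemma LipEstimate.mono {μ : Measure X} {p : ℝ} {x y : X} {C C' L L' : ℝ}
    (h : LipEstimate μ p x y C L) (hC : C ≤ C') (hL : L ≤ L') : LipEstimate μ p x y C' L' :=
  fun u hu => (h u hu).trans (rieszEnergy_mono μ p hC hL x y _)

lemma UpperGradientEstimate.mono {μ : Measure X} {p : ℝ} {x y : X} {C C' L L' : ℝ}
    (h : UpperGradientEstimate μ p x y C L) (hC : C ≤ C') (hL : L ≤ L') :
    UpperGradientEstimate μ p x y C' L' :=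
  fun u hu g hg => (h u hu g hg).trans (rieszEnergy_mono μ p hC hL x y _)

/-- By monotonicity in `ε` the limit exists and is the supremum over all scales, so a bound at each
scale is enough. -/
lemma chainConnectivity_of_chainInf_le {μ : Measure X} {p : ℝ} {x y : X} {C L : ℝ}
    (h : ∀ g : X → ℝ≥0∞, Measurable g → g x < ∞ → g y < ∞ → ∀ ε : ℝ, 0 < ε →
      chainInf p C x y g ε ≤ rieszEnergy μ p C L x y g) : ChainConnectivity μ p x y C L := by
  intro g hg hx hy
  refine ⟨_, (chainInf_antitone p C x y g).tendsto_nhdsGT 0, sSup_le ?_⟩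
  rintro _ ⟨ε, hε, rfl⟩
  exact h g hg hx hy ε hε

/-- A larger `C` also admits longer chains, so the infimum decreases while the energy increases. -/
lemma ChainConnectivity.mono {μ : Measure X} {p : ℝ} {x y : X} {C C' L L' : ℝ}
    (h : ChainConnectivity μ p x y C L) (hC : C ≤ C') (hL : L ≤ L') :
    ChainConnectivity μ p x y C' L' := by
  intro g hg hx hy
  obtain ⟨l, hl, hle⟩ := h g hg hx hy
  have hlim := (chainInf_antitone p C' x y g).tendsto_nhdsGT 0
  refine ⟨_, hlim, (le_of_tendsto_of_tendsto' hlim hl fun ε => ?_).trans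
    (hle.trans (rieszEnergy_mono μ p hC hL x y g))⟩
  refine biInf_mono fun c hc => ⟨hc.1, hc.2.1, hc.2.2.1, hc.2.2.2.trans ?_⟩
  gcongr

lemma ChainConnectivity.epsUpperGradientEstimate {μ : Measure X} {p : ℝ} (hp : 0 ≤ p) {x y : X}
    {C L : ℝ} (h : ChainConnectivity μ p x y C L) : EpsUpperGradientEstimate μ p x y C L := by
  intro u _ ε hε g hg hgx hgy
  obtain ⟨l, hl, hle⟩ := h g hg.1 hgx hgy
  refine le_trans (ge_of_tendsto hl ?_) hle
  filter_upwards [Ioo_mem_nhdsGT hε] with ε' hε'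
  refine le_iInf₂ fun c hc => ?_
  refine ENNReal.rpow_le_rpow ?_ hp
  have := hg.2 c fun i => (hc.1 i).trans hε'.2.le
  rwa [hc.2.1, hc.2.2.1, edist_comm] at this

end Easy

/-! ### Doubling measures: comparison of balls. -/

section Doubling

variable {X : Type*} [MetricSpace X] [MeasurableSpace X] [BorelSpace X] {μ : Measure X} {CD : ℝ}

namespace IsDoublingMetricMeasureSpace

lemma measure_ball_lt_top (h : IsDoublingMetricMeasureSpace μ CD) (x : X) (r : ℝ) :
    μ (Metric.ball x r) < ∞ := h.finite_on_bounded _ Metric.isBounded_ball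

lemma isLocallyFiniteMeasure (h : IsDoublingMetricMeasureSpace μ CD) :
    IsLocallyFiniteMeasure μ :=
  ⟨fun x => ⟨_, Metric.ball_mem_nhds x one_pos, h.measure_ball_lt_top x 1⟩⟩

lemma measure_ball_two_pow_mul_le (h : IsDoublingMetricMeasureSpace μ CD) (x : X) {r : ℝ}
    (hr : 0 < r) (n : ℕ) :
    μ (Metric.ball x (2 ^ n * r)) ≤ ENNReal.ofReal CD ^ n * μ (Metric.ball x r) := by
  induction n with
  | zero => simp
  | succ n ih =>
    have h1 := h.doubling x (2 ^ n * r) (by positivity)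
    rw [← mul_assoc, ← pow_succ'] at h1
    calc _ ≤ _ := h1
      _ ≤ ENNReal.ofReal CD * (ENNReal.ofReal CD ^ n * μ (Metric.ball x r)) := by gcongr
      _ = _ := by rw [← mul_assoc, ← pow_succ']

/-- Comparison of the measures of two balls, the first contained in the `2 ^ n`-fold enlargement of
the second. -/
lemma measure_ball_le (h : IsDoublingMetricMeasureSpace μ CD) {x y : X} {r s : ℝ} (hr : 0 < r)
    (n : ℕ) (hs : s + dist x y ≤ 2 ^ n * r) :
    μ (Metric.ball y s) ≤ ENNReal.ofReal CD ^ n * μ (Metric.ball x r) := by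
  refine (measure_mono ?_).trans (h.measure_ball_two_pow_mul_le x hr n)
  exact Metric.ball_subset_ball' (by rwa [dist_comm])

/-- A null ball would make all its dyadic enlargements null, and these exhaust the space. -/
lemma measure_ball_pos (h : IsDoublingMetricMeasureSpace μ CD) (x : X) {r : ℝ} (hr : 0 < r) :
    0 < μ (Metric.ball x r) := by
  rw [pos_iff_ne_zero]
  intro h0
  apply h.nontrivial
  rw [← Measure.measure_univ_eq_zero]
  have h1 : ∀ n : ℕ, μ (Metric.ball x (2 ^ n * r)) = 0 := fun n => by
    simpa [h0] using h.measure_ball_two_pow_mul_le x hr n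
  refine measure_mono_null (fun z _ => ?_) (measure_iUnion_null h1)
  obtain ⟨n, hn⟩ := pow_unbounded_of_one_lt (dist z x / r) (one_lt_two (α := ℝ))
  exact mem_iUnion.2 ⟨n, Metric.mem_ball.2 ((div_lt_iff₀ hr).1 hn)⟩

end IsDoublingMetricMeasureSpace

end Doubling

/-! ### The Riesz kernel has finite mass; from upper gradients along chains to Lipschitz functions.
-/

section Kernel

variable {X : Type*} [MetricSpace X] [MeasurableSpace X]

/-- The Riesz kernel with pole `x`, without truncation. -/
noncomputable def poleKernel (μ : Measure X) (x z : X) : ℝ≥0∞ := edist x z / μ (Metric.ball x (dist x z))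

variable [BorelSpace X] {μ : Measure X} {CD : ℝ}

lemma measurable_poleKernel (μ : Measure X) (x : X) : Measurable (poleKernel μ x) := by
  have h1 : Monotone fun r : ℝ => μ (Metric.ball x r) :=
    fun r s h => measure_mono (Metric.ball_subset_ball h)
  have h2 : Measurable fun z => dist x z := (continuous_const.dist continuous_id).measurable
  have h3 : Measurable fun z => edist x z := (continuous_const.edist continuous_id).measurable
  exact h3.div (h1.measurable.comp h2)

lemma measurableSet_doubleBall (L : ℝ) (x y : X) : MeasurableSet (doubleBall L x y) :=
  Metric.isOpen_ball.measurableSet.union Metric.isOpen_ball.measurableSet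

lemma measurable_rieszKernel (μ : Measure X) (L : ℝ) (x y : X) :
    Measurable (rieszKernel μ L x y) := by
  unfold rieszKernel
  refine Measurable.ite ?_ ((measurable_poleKernel μ x).add (measurable_poleKernel μ y))
    measurable_const
  exact (measurableSet_doubleBall L x y).inter
    ((measurableSet_singleton x).compl.inter (measurableSet_singleton y).compl)

/-- On the dyadic annulus `A k` the kernel is at most `2⁻ᵏ T / m`, with `m` the mass of the inner
ball, and the annulus has mass at most `CD * m`. The factor `2` is the sum of the geometric series.
-/
lemma lintegral_poleKernel_le (h : IsDoublingMetricMeasureSpace μ CD) (x : X) {T : ℝ}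
    (hT : 0 < T) :
    ∫⁻ z in Metric.ball x T \ {x}, poleKernel μ x z ∂μ ≤
      2 * ENNReal.ofReal CD * ENNReal.ofReal T := by
  set A : ℕ → Set X := fun k => {z | 2⁻¹ ^ (k + 1) * T ≤ dist x z ∧ dist x z < 2⁻¹ ^ k * T}
  have hsub : Metric.ball x T \ {x} ⊆ ⋃ k, A k := by
    rintro z ⟨hz, hne⟩
    have hpos : 0 < dist x z := dist_pos.2 fun e => hne e.symm
    rw [Metric.mem_ball, dist_comm] at hz
    obtain ⟨n, h1, h2⟩ := exists_nat_pow_near_of_lt_one (x := dist x z / T) (y := (2 : ℝ)⁻¹)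
      (by positivity) ((div_le_one hT).2 hz.le) (by norm_num) (by norm_num)
    by_cases h3 : dist x z < 2⁻¹ ^ n * T
    · exact mem_iUnion.2 ⟨n, ((lt_div_iff₀ hT).1 h1).le, h3⟩
    -- The dyadic intervals provided are closed on the right, the annuli on the left; a boundary
    -- point belongs to the next annulus outwards, which exists because `dist x z < T`.
    · have h4 : dist x z = 2⁻¹ ^ n * T := le_antisymm ((div_le_iff₀ hT).1 h2) (not_lt.1 h3)
      cases n with
      | zero => simp at h4; linarith
      | succ n =>
        refine mem_iUnion.2 ⟨n, h4.ge, ?_⟩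
        rw [h4]
        have : (0 : ℝ) < 2⁻¹ ^ n := by positivity
        rw [pow_succ]; nlinarith
  have hA : ∀ k, ∫⁻ z in A k, poleKernel μ x z ∂μ ≤
      2⁻¹ ^ k * (ENNReal.ofReal CD * ENNReal.ofReal T) := by
    intro k
    have hr : 0 < (2⁻¹ : ℝ) ^ (k + 1) * T := by positivity
    have hm0 := (h.measure_ball_pos x hr).ne'
    have hmt := (h.measure_ball_lt_top x ((2⁻¹ : ℝ) ^ (k + 1) * T)).ne
    set m := μ (Metric.ball x ((2⁻¹ : ℝ) ^ (k + 1) * T)) with hm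
    have h2r : (2⁻¹ : ℝ) ^ k * T = 2 * ((2⁻¹ : ℝ) ^ (k + 1) * T) := by rw [pow_succ]; ring
    have h1 : ∀ z ∈ A k, poleKernel μ x z ≤ ENNReal.ofReal (2⁻¹ ^ k * T) / m := by
      rintro z ⟨hz1, hz2⟩
      unfold poleKernel
      rw [edist_dist]
      gcongr
      exact measure_mono (Metric.ball_subset_ball hz1)
    have h2 : A k ⊆ Metric.ball x (2⁻¹ ^ k * T) := fun z hz => by
      rw [Metric.mem_ball, dist_comm]; exact hz.2
    have h3 : μ (A k) ≤ ENNReal.ofReal CD * m := by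
      refine (measure_mono h2).trans ?_
      rw [h2r]
      exact h.doubling x _ hr
    calc _ ≤ ∫⁻ z in A k, ENNReal.ofReal (2⁻¹ ^ k * T) / m ∂μ := by
            have hc : Continuous fun z => dist x z := continuous_const.dist continuous_id
            have hAm : MeasurableSet (A k) :=
              (isClosed_le continuous_const hc).measurableSet.inter
                (isOpen_lt hc continuous_const).measurableSet
            exact setLIntegral_mono' hAm h1
      _ = ENNReal.ofReal (2⁻¹ ^ k * T) / m * μ (A k) := by simp
      _ ≤ ENNReal.ofReal (2⁻¹ ^ k * T) / m * (ENNReal.ofReal CD * m) := by gcongr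
      _ = ENNReal.ofReal (2⁻¹ ^ k * T) * ENNReal.ofReal CD * (m⁻¹ * m) := by
            rw [div_eq_mul_inv]; ring
      _ = _ := by
            rw [ENNReal.inv_mul_cancel hm0 hmt, ENNReal.ofReal_mul (by positivity),
              ENNReal.ofReal_pow (by positivity), ENNReal.ofReal_inv_of_pos two_pos]
            simp only [ENNReal.ofReal_ofNat]
            ring
  calc _ ≤ ∫⁻ z in ⋃ k, A k, poleKernel μ x z ∂μ := lintegral_mono_set hsub
    _ ≤ ∑' k, ∫⁻ z in A k, poleKernel μ x z ∂μ := lintegral_iUnion_le _ _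
    _ ≤ ∑' k : ℕ, 2⁻¹ ^ k * (ENNReal.ofReal CD * ENNReal.ofReal T) := ENNReal.tsum_le_tsum hA
    _ = _ := by
      rw [ENNReal.tsum_mul_right, ENNReal.tsum_geometric, ENNReal.one_sub_inv_two, inv_inv,
        mul_assoc]

/-- The truncation region lies in the ball of radius `2 L d(x,y)` about either pole, so the mass is
at most that of two single-pole kernels, each at most `2 CD · 2 L d(x,y)`. -/
lemma rieszMeasure_univ_le (h : IsDoublingMetricMeasureSpace μ CD) {L : ℝ} (hL : 1 ≤ L) {x y : X}
    (hxy : x ≠ y) :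
    rieszMeasure μ L x y univ ≤ ENNReal.ofReal (8 * CD * L) * edist x y := by
  have hd : 0 < dist x y := dist_pos.2 hxy
  rcases le_or_gt CD 0 with hCD | hCD
  · have h1 := h.doubling x 1 one_pos
    rw [ENNReal.ofReal_of_nonpos hCD, zero_mul] at h1
    exact absurd h1 (h.measure_ball_pos x (by norm_num)).not_ge
  set T := 2 * L * dist x y with hT
  have hT0 : 0 < T := by positivity
  have hLd : dist x y ≤ L * dist x y := by nlinarith
  have hx : doubleBall L x y ⊆ Metric.ball x T := by
    refine union_subset (Metric.ball_subset_ball (by nlinarith)) (Metric.ball_subset_ball' ?_)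
    rw [dist_comm y x]; nlinarith
  have hy : doubleBall L x y ⊆ Metric.ball y T := by
    refine union_subset (Metric.ball_subset_ball' ?_) (Metric.ball_subset_ball (by nlinarith))
    nlinarith
  have hk : ∀ z, rieszKernel μ L x y z ≤
      (Metric.ball x T \ {x}).indicator (poleKernel μ x) z +
      (Metric.ball y T \ {y}).indicator (poleKernel μ y) z := by
    intro z
    unfold rieszKernel
    split_ifs with hz
    · rw [indicator_of_mem (show z ∈ Metric.ball x T \ {x} from ⟨hx hz.1, hz.2.1⟩),
        indicator_of_mem (show z ∈ Metric.ball y T \ {y} from ⟨hy hz.1, hz.2.2⟩)]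
      rfl
    · exact zero_le
  have hmx : MeasurableSet (Metric.ball x T \ {x}) :=
    Metric.isOpen_ball.measurableSet.diff (measurableSet_singleton x)
  have hmy : MeasurableSet (Metric.ball y T \ {y}) :=
    Metric.isOpen_ball.measurableSet.diff (measurableSet_singleton y)
  unfold rieszMeasure
  rw [withDensity_apply _ MeasurableSet.univ, Measure.restrict_univ]
  calc _ ≤ _ := lintegral_mono hk
    _ = ∫⁻ z in Metric.ball x T \ {x}, poleKernel μ x z ∂μ +
        ∫⁻ z in Metric.ball y T \ {y}, poleKernel μ y z ∂μ := by
      rw [lintegral_add_left ((measurable_poleKernel μ x).indicator hmx),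
        lintegral_indicator hmx, lintegral_indicator hmy]
    _ ≤ 2 * ENNReal.ofReal CD * ENNReal.ofReal T + 2 * ENNReal.ofReal CD * ENNReal.ofReal T :=
      add_le_add (lintegral_poleKernel_le h x hT0) (lintegral_poleKernel_le h y hT0)
    _ = _ := by
      rw [edist_dist, ← ENNReal.ofReal_mul (by positivity), ← ENNReal.ofReal_ofNat 2,
        ← ENNReal.ofReal_mul (by positivity), ← ENNReal.ofReal_mul (by positivity),
        ← ENNReal.ofReal_add (by positivity) (by positivity)]
      congr 1
      rw [hT]; ring

lemma isFiniteMeasure_rieszMeasure (h : IsDoublingMetricMeasureSpace μ CD) {L : ℝ} (hL : 1 ≤ L)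
    {x y : X} (hxy : x ≠ y) : IsFiniteMeasure (rieszMeasure μ L x y) :=
  ⟨(rieszMeasure_univ_le h hL hxy).trans_lt
    (ENNReal.mul_lt_top ENNReal.ofReal_lt_top (edist_lt_top _ _))⟩

lemma edist_rpow_ne_top {X : Type*} [MetricSpace X] (x y : X) {q : ℝ} (hq : 0 ≤ q) : edist x y ^ q ≠ ∞ :=
  ENNReal.rpow_ne_top_of_nonneg hq (edist_ne_top _ _)

/-- The estimate is applied to the slopes at scale `1 / (n + 1)`. They decrease to `localLip u` and
are bounded by the Lipschitz constant, which is integrable for the finite Riesz measure. -/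
lemma EpsUpperGradientEstimate.lipEstimate (h : IsDoublingMetricMeasureSpace μ CD) {p : ℝ}
    (hp : 1 ≤ p) {C L : ℝ} (hL : 1 ≤ L) {x y : X}
    (H : EpsUpperGradientEstimate μ p x y C L) : LipEstimate μ p x y C L := by
  rintro u ⟨K, hu⟩
  rcases eq_or_ne x y with rfl | hxy
  · simp [ENNReal.zero_rpow_of_pos (zero_lt_one.trans_le hp)]
  have := isFiniteMeasure_rieszMeasure h hL hxy
  have hp0 : 0 ≤ p := zero_le_one.trans hp
  have hn : ∀ n : ℕ, edist (u x) (u y) ^ p ≤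
      rieszEnergy μ p C L x y (slope (1 / ((n : ℝ) + 1)) u) := by
    intro n
    have hpos : (0 : ℝ) < 1 / ((n : ℝ) + 1) := by positivity
    exact H u hu.continuous.measurable _ (half_pos hpos) _
      (isEpsUpperGradient_slope hu.continuous (half_lt_self hpos))
      ((slope_le_of_lipschitz hu x).trans_lt ENNReal.coe_lt_top)
      ((slope_le_of_lipschitz hu y).trans_lt ENNReal.coe_lt_top)
  refine ge_of_tendsto' (a := rieszEnergy μ p C L x y (localLip u)) (x := atTop) ?_ hn
  unfold rieszEnergy
  refine ENNReal.Tendsto.const_mul ?_ (Or.inr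
    (ENNReal.mul_ne_top ENNReal.ofReal_ne_top (edist_rpow_ne_top x y (by linarith))))
  refine tendsto_lintegral_of_dominated_convergence (fun _ => (K : ℝ≥0∞) ^ p) ?_ ?_ ?_ ?_
  · exact fun n => (lowerSemicontinuous_slope hu.continuous).measurable.pow_const p
  · exact fun n => ae_of_all _ fun z => ENNReal.rpow_le_rpow (slope_le_of_lipschitz hu z) hp0
  · rw [lintegral_const]
    exact ENNReal.mul_ne_top (ENNReal.rpow_ne_top_of_nonneg hp0 ENNReal.coe_ne_top)
      (measure_ne_top _ _)
  · exact ae_of_all _ fun z =>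
      (ENNReal.continuous_rpow_const.tendsto _).comp (tendsto_slope_localLip u z)

end Kernel

/-! ### The chain distance as a test function. -/

section ChainFunction

variable {X : Type*} [MetricSpace X]

/-- The infimum of the `G`-integrals over the `ε`-chains from `x` to `z`. -/
noncomputable def chainCostInf (ε : ℝ) (G : X → ℝ≥0∞) (x z : X) : ℝ≥0∞ :=
  ⨅ (t : ℝ≥0∞) (_ : ChainCost ε G x z t), t

lemma chainCostInf_self (ε : ℝ) (G : X → ℝ≥0∞) (x : X) : chainCostInf ε G x x = 0 :=
  le_antisymm (iInf₂_le 0 ChainCost.refl) zero_le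

lemma chainCostInf_le_add {ε : ℝ} {G : X → ℝ≥0∞} {x z w : X} (h : dist z w ≤ ε) :
    chainCostInf ε G x w ≤ chainCostInf ε G x z + (G z + G w) / 2 * edist z w := by
  unfold chainCostInf
  simp only [ENNReal.iInf_add]
  exact le_iInf₂ fun t ht => iInf₂_le _ (ht.step h)

lemma exists_chainCost_lt {ε : ℝ} {G : X → ℝ≥0∞} {x z : X} {B : ℝ≥0∞}
    (h : chainCostInf ε G x z < B) : ∃ t < B, ChainCost ε G x z t := by
  obtain ⟨t, ht, h'⟩ := by simpa [chainCostInf, iInf_lt_iff] using h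
  exact ⟨t, h', ht⟩

/-- The truncated chain distance from `x`. -/
noncomputable def chainFun (ε : ℝ) (G : X → ℝ≥0∞) (x : X) (T : NNReal) (z : X) : ℝ :=
  (min (T : ℝ≥0∞) (chainCostInf ε G x z)).toReal

lemma edist_toReal_le {a b c : ℝ≥0∞} (ha : a ≠ ∞) (hb : b ≠ ∞) (h1 : a ≤ b + c) (h2 : b ≤ a + c) :
    edist a.toReal b.toReal ≤ c := by
  rcases eq_or_ne c ∞ with rfl | hc
  · exact le_top
  lift a to NNReal using ha
  lift b to NNReal using hb
  lift c to NNReal using hc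
  norm_cast at h1 h2
  rw [edist_dist, Real.dist_eq, ENNReal.coe_toReal, ENNReal.coe_toReal, ← ENNReal.ofReal_coe_nnreal]
  refine ENNReal.ofReal_le_ofReal (abs_le.2 ⟨?_, ?_⟩)
  · have : (b : ℝ) ≤ a + c := by exact_mod_cast h2
    linarith
  · have : (a : ℝ) ≤ b + c := by exact_mod_cast h1
    linarith

variable {ε : ℝ} {G : X → ℝ≥0∞} {x : X} {T : NNReal}

lemma min_chainCostInf_ne_top (z : X) : min (T : ℝ≥0∞) (chainCostInf ε G x z) ≠ ∞ :=
  ((min_le_left _ _).trans_lt ENNReal.coe_lt_top).ne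

lemma edist_chainFun_le {z w : X} (h : dist z w ≤ ε) :
    edist (chainFun ε G x T z) (chainFun ε G x T w) ≤ (G z + G w) / 2 * edist z w := by
  refine edist_toReal_le (min_chainCostInf_ne_top z) (min_chainCostInf_ne_top w) ?_ ?_
  · rw [min_add]
    refine min_le_min le_self_add ?_
    rw [add_comm (G z), edist_comm]
    exact chainCostInf_le_add (by rwa [dist_comm])
  · rw [min_add]
    exact min_le_min le_self_add (chainCostInf_le_add h)

/-- Within distance `ε` a single step costs at most `M` times the distance; beyond it the truncation
bounds the increment by `T`, less than `T / ε` times the distance. -/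
lemma exists_lipschitzWith_chainFun (hε : 0 < ε) {M : NNReal} (hG : ∀ z, G z ≤ M) :
    ∃ K, LipschitzWith K (chainFun ε G x T) := by
  refine ⟨M + T / ε.toNNReal, fun z w => ?_⟩
  rcases le_or_gt (dist z w) ε with h | h
  · refine (edist_chainFun_le h).trans ?_
    gcongr
    rw [ENNReal.div_le_iff (by simp) (by simp), mul_two]
    push_cast
    exact add_le_add ((hG z).trans le_self_add) ((hG w).trans le_self_add)
  · have h1 : edist (chainFun ε G x T z) (chainFun ε G x T w) ≤ T := by
      refine edist_toReal_le (min_chainCostInf_ne_top z) (min_chainCostInf_ne_top w) ?_ ?_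
      · exact (min_le_left _ _).trans le_add_self
      · exact (min_le_left _ _).trans le_add_self
    refine h1.trans ?_
    have h2 : (T : ℝ≥0∞) = (T / ε.toNNReal : NNReal) * ENNReal.ofReal ε := by
      rw [ENNReal.ofReal]
      norm_cast
      rw [div_mul_cancel₀]
      simpa using hε
    rw [h2, edist_dist]
    gcongr
    exact le_add_self

/-- Any two points closer than `ε` are joined by one step, whose cost is the mean of `G` at its ends
times the distance. -/
lemma localLip_chainFun_le (hε : 0 < ε) {z : X} {a : ℝ≥0∞}
    (h : ∃ δ > 0, ∀ w ∈ Metric.ball z δ, G w ≤ a) : localLip (chainFun ε G x T) z ≤ a := by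
  obtain ⟨δ, hδ, h⟩ := h
  refine (localLip_le_slope (lt_min hδ hε) _ _).trans (iSup₂_le fun w hw => ?_)
  rw [Metric.mem_ball, lt_min_iff] at hw
  refine ENNReal.div_le_of_le_mul ((edist_chainFun_le hw.2.le).trans ?_)
  gcongr
  rw [ENNReal.div_le_iff (by simp) (by simp), mul_two]
  exact add_le_add (h w hw.1) (h z (Metric.mem_ball_self hδ))

/-- Applying the pointwise estimate to the chain function of a bounded `G`. -/
lemma LipEstimate.chainCostInf_rpow_le [MeasurableSpace X] {μ : Measure X} {p C L : ℝ} {y : X}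
    (hE : LipEstimate μ p x y C L) (hp : 0 < p) (hε : 0 < ε) {M : NNReal} (hG : ∀ z, G z ≤ M)
    {H : X → ℝ≥0∞} (hH : ∀ z, ∃ δ > 0, ∀ w ∈ Metric.ball z δ, G w ≤ H z) :
    chainCostInf ε G x y ^ p ≤ rieszEnergy μ p C L x y H := by
  have key : ∀ T : NNReal, min (T : ℝ≥0∞) (chainCostInf ε G x y) ^ p ≤
      rieszEnergy μ p C L x y H := by
    intro T
    have h1 := hE (chainFun ε G x T) (exists_lipschitzWith_chainFun hε hG)
    have h2 : edist (chainFun ε G x T x) (chainFun ε G x T y) =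
        min (T : ℝ≥0∞) (chainCostInf ε G x y) := by
      rw [edist_comm]
      unfold chainFun
      rw [chainCostInf_self]
      simp only [zero_le, inf_of_le_right, ENNReal.toReal_zero]
      rw [edist_dist, Real.dist_0_eq_abs, abs_of_nonneg ENNReal.toReal_nonneg,
        ENNReal.ofReal_toReal (min_chainCostInf_ne_top y)]
    rw [h2] at h1
    refine h1.trans ?_
    unfold rieszEnergy
    gcongr with z
    exact localLip_chainFun_le hε (hH z)
  -- Letting `T → ∞` covers the case where no chain reaches `y` as well: the energy is then forced
  -- to be infinite.
  have h3 : Tendsto (fun n : ℕ => min ((n : NNReal) : ℝ≥0∞) (chainCostInf ε G x y) ^ p) atTop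
      (𝓝 (min ∞ (chainCostInf ε G x y) ^ p)) := by
    refine (ENNReal.continuous_rpow_const.tendsto _).comp (Tendsto.min ?_ tendsto_const_nhds)
    simpa using ENNReal.tendsto_nat_nhds_top
  rw [min_eq_right le_top] at h3
  exact le_of_tendsto' h3 fun n => key n

end ChainFunction

/-! ### From fine chains for an averaged cost to coarse chains for the original one. -/

section Coarsening

variable {X : Type*} [MetricSpace X]

/-- The radius `min (ε, d(z,x), d(z,y)) / 16` of a Whitney-type family of balls. -/
noncomputable def poleRadius (ε : ℝ) (x y z : X) : ℝ := min ε (min (dist z x) (dist z y)) / 16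

variable {ε : ℝ} {x y : X}

lemma poleRadius_le_eps (z : X) : poleRadius ε x y z ≤ ε / 16 := by
  unfold poleRadius
  gcongr
  exact min_le_left _ _

lemma poleRadius_le_left (z : X) : poleRadius ε x y z ≤ dist z x / 16 := by
  unfold poleRadius
  gcongr
  exact (min_le_right _ _).trans (min_le_left _ _)

lemma poleRadius_le_right (z : X) : poleRadius ε x y z ≤ dist z y / 16 := by
  unfold poleRadius
  gcongr
  exact (min_le_right _ _).trans (min_le_right _ _)

lemma le_poleRadius {s : ℝ} {z : X} (h : s ≤ ε) (hx : s ≤ dist z x) (hy : s ≤ dist z y) :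
    s / 16 ≤ poleRadius ε x y z := by
  unfold poleRadius
  gcongr
  exact le_min h (le_min hx hy)

/-- A minimum of `1`-Lipschitz functions divided by `16`: radii at nearby points of the Whitney
family are comparable. -/
lemma poleRadius_le_add (z w : X) :
    poleRadius ε x y z ≤ poleRadius ε x y w + dist z w / 16 := by
  unfold poleRadius
  rw [← add_div]
  gcongr
  rw [← min_add_add_right, ← min_add_add_right]
  refine min_le_min (le_add_of_nonneg_right dist_nonneg) (min_le_min ?_ ?_)
  · rw [add_comm]; exact dist_triangle z w x
  · rw [add_comm]; exact dist_triangle z w y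

lemma poleRadius_pos (hε : 0 < ε) {z : X} (hx : z ≠ x) (hy : z ≠ y) :
    0 < poleRadius ε x y z := by
  unfold poleRadius
  have := dist_pos.2 hx
  have := dist_pos.2 hy
  positivity

lemma continuous_poleRadius (ε : ℝ) (x y : X) : Continuous (poleRadius ε x y) := by
  unfold poleRadius
  fun_prop

lemma half_add_mul_le {a b c r : ℝ≥0∞} (hr : c ≤ 2 * r) : (a + b) / 2 * c ≤ r * a + r * b := by
  calc (a + b) / 2 * c ≤ (a + b) / 2 * (2 * r) := by gcongr
    _ = ((a + b) / 2 * 2) * r := by ring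
    _ = (a + b) * r := by rw [ENNReal.div_mul_cancel (by simp) (by simp)]
    _ = _ := by ring

/-- Turning a fine chain for a locally averaged cost `G` into a coarse chain for the cost `f`. -/
lemma ChainCost.exists_coarse {s ε' : ℝ} {A f G : X → ℝ≥0∞} {φ : X → X} {M B β : ℝ≥0∞}
    (hs : 0 < s) (hsε : 4 * s ≤ ε) (hsd : 4 * s ≤ dist x y) (hε' : ε' ≤ s / 64)
    (hφ : ∀ p, s ≤ dist p x → s ≤ dist p y →
      dist (φ p) p < poleRadius ε x y p ∧ f (φ p) ≤ A p)
    (hG : ∀ p w, s ≤ dist p x → s ≤ dist p y → s ≤ dist w x → s ≤ dist w y →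
      dist p w < poleRadius ε x y p → min M (A p) ≤ G w)
    (hM : B < M * ENNReal.ofReal (s / 32))
    (hβ : ∀ p, s ≤ dist p x → s ≤ dist p y → (dist p x ≤ 2 * s ∨ dist p y ≤ 2 * s) →
      ENNReal.ofReal s * A p ≤ β)
    (hβx : ENNReal.ofReal s * f x ≤ β) (hβy : ENNReal.ofReal s * f y ≤ β)
    {t : ℝ≥0∞} (ht : ChainCost ε' G x y t) (htB : t ≤ B) :
    ∃ τ, ChainCost ε f x y τ ∧ τ ≤ 10 * t + 5 * β := by
  set ρ := poleRadius ε x y with hρ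
  -- Invariant along the fine chain, in three states: still within `s` of `x`; following an anchor
  -- `p`, with a coarse chain ending at `φ p`, where `tp` is the fine cost already spent when `p`
  -- became the anchor; or finished at `y`. The term `3 ρ(p) A(p)` is a debt, repaid once the fine
  -- chain has travelled `ρ(p) / 2` away from `p`.
  have key : ∀ z t, ChainCost ε' G x z t → t ≤ B →
      dist z x < s ∨
      (∃ p tp τ, ChainCost ε f x (φ p) τ ∧ s ≤ dist p x ∧ s ≤ dist p y ∧ s ≤ dist z x ∧
        s ≤ dist z y ∧ dist p z < ρ p / 2 ∧ τ ≤ 2 * β + 10 * tp + 3 * ENNReal.ofReal (ρ p) * A p ∧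
        tp + min M (A p) * edist p z ≤ t) ∨
      ∃ τ, ChainCost ε f x y τ ∧ τ ≤ 10 * t + 5 * β := by
    intro z t h
    induction h with
    | refl => intro _; left; simpa using hs
    | @step z w t _ hd ih =>
      intro htB
      have htB' : t ≤ B := le_self_add.trans htB
      have hwx : dist w x ≤ dist z w + dist z x := by
        rw [dist_comm z w]; exact dist_triangle w z x
      rcases ih htB' with ha | ⟨p, tp, τ, hτ, hpx, hpy, hzx, hzy, hpz, hτle, htp⟩ | ⟨τ, hτ, hle⟩
      · by_cases hwx' : dist w x < s
        · exact Or.inl hwx'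
        push Not at hwx'
        have hwy : s ≤ dist w y := by
          have := dist_triangle_left x y w
          linarith
        have h2 : dist w x ≤ 2 * s := by linarith
        obtain ⟨hφ1, hφ2⟩ := hφ w hwx' hwy
        have hρw : ρ w ≤ dist w x / 16 := poleRadius_le_left w
        have hρ0 : s / 16 ≤ ρ w := le_poleRadius (by linarith) hwx' hwy
        have hstep : dist x (φ w) ≤ 2 * s := by
          have h3 := dist_triangle_right x (φ w) w
          rw [dist_comm x w] at h3
          linarith
        refine Or.inr (Or.inl ⟨w, t + (G z + G w) / 2 * edist z w, _,
          ChainCost.refl.step (hstep.trans (by linarith)), hwx', hwy, hwx', hwy, ?_, ?_, ?_⟩)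
        · rw [dist_self]; linarith
        · rw [zero_add]
          have h4 : edist x (φ w) ≤ 2 * ENNReal.ofReal s := by
            rw [edist_dist, ← ENNReal.ofReal_ofNat, ← ENNReal.ofReal_mul (by norm_num)]
            exact ENNReal.ofReal_le_ofReal hstep
          refine (half_add_mul_le h4).trans ?_
          have h5 : ENNReal.ofReal s * f (φ w) ≤ β :=
            (by gcongr : _ ≤ ENNReal.ofReal s * A w).trans (hβ w hwx' hwy (Or.inl h2))
          calc _ ≤ β + β := add_le_add hβx h5
            _ = 2 * β := (two_mul β).symm
            _ ≤ _ := by rw [add_assoc]; exact le_self_add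
        · simp
      -- On returning close to `x` the coarse chain built so far is discarded and the construction
      -- restarts.
      · by_cases hwx' : dist w x < s
        · exact Or.inl hwx'
        push Not at hwx'
        have hρ0 : s / 16 ≤ ρ p := le_poleRadius (by linarith) hpx hpy
        have hρε : ρ p ≤ ε / 16 := poleRadius_le_eps p
        have hpw : dist p w ≤ dist p z + dist z w := dist_triangle p z w
        obtain ⟨hφ1, hφ2⟩ := hφ p hpx hpy
        by_cases hwy : dist w y < s
        · have hρy : ρ p ≤ dist p y / 16 := poleRadius_le_right p
          have hpy' := dist_triangle p w y
          have h2 : dist p y ≤ 3 / 2 * s := by linarith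
          have hstep : dist (φ p) y ≤ 2 * s := by
            have := dist_triangle (φ p) p y
            linarith
          have h4 : edist (φ p) y ≤ 2 * ENNReal.ofReal s := by
            rw [edist_dist, ← ENNReal.ofReal_ofNat, ← ENNReal.ofReal_mul (by norm_num)]
            exact ENNReal.ofReal_le_ofReal hstep
          have hAβ := hβ p hpx hpy (Or.inr (by linarith))
          refine Or.inr (Or.inr ⟨_, hτ.step (hstep.trans (by linarith)), ?_⟩)
          -- Near `y` the debt is itself negligible: `ρ p ≤ d(p,y) / 16` and `d(p,y) ≤ 3s / 2`.
          have h5 : 3 * ENNReal.ofReal (ρ p) * A p ≤ β := by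
            refine le_trans ?_ hAβ
            gcongr
            rw [← ENNReal.ofReal_ofNat, ← ENNReal.ofReal_mul (by norm_num)]
            exact ENNReal.ofReal_le_ofReal (by linarith)
          have h6 : tp ≤ t := le_self_add.trans htp
          calc _ ≤ (2 * β + 10 * tp + 3 * ENNReal.ofReal (ρ p) * A p) +
                (ENNReal.ofReal s * f (φ p) + ENNReal.ofReal s * f y) :=
                add_le_add hτle (half_add_mul_le h4)
            _ ≤ (2 * β + 10 * t + β) + (ENNReal.ofReal s * A p + β) := by gcongr
            _ ≤ (2 * β + 10 * t + β) + (β + β) := by gcongr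
            _ = 10 * t + 5 * β := by ring
            _ ≤ _ := by gcongr; exact le_self_add
        push Not at hwy
        have hGz : min M (A p) ≤ G z := hG p z hpx hpy hzx hzy (by linarith)
        have hGw : min M (A p) ≤ G w := hG p w hpx hpy hwx' hwy (by linarith)
        have hnew : tp + min M (A p) * edist p w ≤ t + (G z + G w) / 2 * edist z w := by
          calc tp + min M (A p) * edist p w
              ≤ tp + min M (A p) * (edist p z + edist z w) := by
                gcongr; exact edist_triangle _ _ _
            _ = (tp + min M (A p) * edist p z) + min M (A p) * edist z w := by ring
            _ ≤ _ := by
              gcongr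
              rw [ENNReal.le_div_iff_mul_le (by simp) (by simp), mul_two]
              exact add_le_add hGz hGw
        by_cases hclose : dist p w < ρ p / 2
        · exact Or.inr (Or.inl ⟨p, tp, τ, hτ, hpx, hpy, hwx', hwy, hclose, hτle, hnew⟩)
        push Not at hclose
        -- The fine chain has moved at least `ρ p / 2 ≥ s / 32` from `p`; had the truncation at `M`
        -- been active, this alone would exceed the budget `B`.
        have hm : min M (A p) = A p := by
          by_contra hne
          have hmM : min M (A p) = M := (min_choice M (A p)).resolve_right hne
          rw [hmM] at hnew
          have : M * ENNReal.ofReal (s / 32) ≤ B := by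
            refine le_trans ?_ (hnew.trans htB)
            refine le_trans ?_ le_add_self
            gcongr
            rw [edist_dist]
            exact ENNReal.ofReal_le_ofReal (by linarith)
          exact absurd hM this.not_gt
        rw [hm] at hnew
        obtain ⟨hφw1, hφw2⟩ := hφ w hwx' hwy
        have hρw1 : ρ w ≤ ρ p + dist w p / 16 := poleRadius_le_add w p
        have hρw2 : ρ p ≤ ρ w + dist p w / 16 := poleRadius_le_add p w
        have hρw0 : s / 16 ≤ ρ w := le_poleRadius (by linarith) hwx' hwy
        rw [dist_comm] at hρw1
        have hstep : dist (φ p) (φ w) ≤ 4 * ρ p := by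
          have h1 := dist_triangle (φ p) p (φ w)
          have h2 := dist_triangle_right p (φ w) w
          change _ < ρ p at hφ1
          change _ < ρ w at hφw1
          linarith
        have h4 : edist (φ p) (φ w) ≤ 2 * (2 * ENNReal.ofReal (ρ p)) := by
          rw [edist_dist, ← mul_assoc, ← ENNReal.ofReal_ofNat,
            ← ENNReal.ofReal_mul (by norm_num), ← ENNReal.ofReal_mul (by norm_num)]
          exact ENNReal.ofReal_le_ofReal (by linarith)
        refine Or.inr (Or.inl ⟨w, t + (G z + G w) / 2 * edist z w, _,
          hτ.step (hstep.trans (by linarith)), hwx', hwy, hwx', hwy, ?_, ?_, ?_⟩)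
        · rw [dist_self]; linarith
        · have h7 : 2 * ENNReal.ofReal (ρ p) ≤ 3 * ENNReal.ofReal (ρ w) := by
            rw [← ENNReal.ofReal_ofNat, ← ENNReal.ofReal_ofNat,
              ← ENNReal.ofReal_mul (by norm_num), ← ENNReal.ofReal_mul (by norm_num)]
            exact ENNReal.ofReal_le_ofReal (by linarith)
          -- Change of anchor: the jump costs `2 ρ(p) A(p) + 3 ρ(w) A(w)`. With the old debt this
          -- makes `5 ρ(p) A(p) ≤ 10 A(p) d(p,w)`, charged to the fine cost, while `3 ρ(w) A(w)` is
          -- the new debt.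
          have h8 : ENNReal.ofReal (ρ p) ≤ 2 * edist p w := by
            rw [edist_dist, ← ENNReal.ofReal_ofNat, ← ENNReal.ofReal_mul (by norm_num)]
            exact ENNReal.ofReal_le_ofReal (by linarith)
          calc _ ≤ (2 * β + 10 * tp + 3 * ENNReal.ofReal (ρ p) * A p) +
                (2 * ENNReal.ofReal (ρ p) * f (φ p) + 2 * ENNReal.ofReal (ρ p) * f (φ w)) :=
                add_le_add hτle (half_add_mul_le h4)
            _ ≤ (2 * β + 10 * tp + 3 * ENNReal.ofReal (ρ p) * A p) +
                (2 * ENNReal.ofReal (ρ p) * A p + 3 * ENNReal.ofReal (ρ w) * A w) := by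
                gcongr
            _ = (2 * β + 10 * tp + 5 * ENNReal.ofReal (ρ p) * A p) +
                3 * ENNReal.ofReal (ρ w) * A w := by ring
            _ ≤ (2 * β + 10 * tp + 5 * (2 * edist p w) * A p) +
                3 * ENNReal.ofReal (ρ w) * A w := by gcongr
            _ = (2 * β + 10 * (tp + A p * edist p w)) + 3 * ENNReal.ofReal (ρ w) * A w := by ring
            _ ≤ _ := by gcongr
        · simp
      · refine Or.inr (Or.inr ⟨τ, hτ, hle.trans ?_⟩)
        gcongr
        exact le_self_add
  -- At `z = y` only the finished state is possible: `y` is at distance at least `4s` from `x` and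
  -- `0` from itself.
  rcases key y t ht htB with h | ⟨p, tp, τ, _, _, _, _, h, _⟩ | h
  · rw [dist_comm] at h; linarith
  · rw [dist_self] at h; linarith
  · exact h

end Coarsening

/-! ### Averages over Whitney balls and the Riesz measure. -/

section Averages

variable {X : Type*} [MetricSpace X] [MeasurableSpace X] [BorelSpace X]
  {μ : Measure X} {CD : ℝ} {x y : X} {ε : ℝ}

lemma ENNReal_inv_le_mul_inv {a b c : ℝ≥0∞} (hc : c ≠ 0) (hc' : c ≠ ∞) (h : a ≤ c * b) :
    b⁻¹ ≤ c * a⁻¹ := by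
  have h1 : a / c ≤ b := ENNReal.div_le_of_le_mul' h
  calc b⁻¹ ≤ (a / c)⁻¹ := ENNReal.inv_le_inv.2 h1
    _ = c * a⁻¹ := by
      rw [ENNReal.inv_div (Or.inl hc') (Or.inl hc), div_eq_mul_inv]

lemma ofReal_pow_ne_zero (hCD : 1 ≤ CD) (n : ℕ) : ENNReal.ofReal CD ^ n ≠ 0 :=
  pow_ne_zero _ (by simpa using zero_lt_one.trans_le hCD)

lemma ofReal_pow_ne_top (n : ℕ) : ENNReal.ofReal CD ^ n ≠ ∞ :=
  ENNReal.pow_ne_top ENNReal.ofReal_ne_top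

lemma poleKernel_le (h : IsDoublingMetricMeasureSpace μ CD) (hCD : 1 ≤ CD) {z w : X}
    (hz : z ≠ x) (hzw : dist z w ≤ dist z x / 4) :
    poleKernel μ x z ≤ 2 * ENNReal.ofReal CD * poleKernel μ x w := by
  have h0 : 0 < dist x z := dist_pos.2 hz.symm
  have h1 := dist_triangle_left z x w
  have h2 := dist_triangle x z w
  rw [dist_comm z x] at h1 hzw
  rw [dist_comm w z, dist_comm w x] at h1
  have h3 : edist x z ≤ 2 * edist x w := by
    rw [edist_dist, edist_dist, ← ENNReal.ofReal_ofNat, ← ENNReal.ofReal_mul (by norm_num)]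
    exact ENNReal.ofReal_le_ofReal (by linarith)
  have h4 : μ (Metric.ball x (dist x w)) ≤
      ENNReal.ofReal CD ^ 1 * μ (Metric.ball x (dist x z)) :=
    h.measure_ball_le h0 1 (by rw [dist_self]; linarith)
  have h5 := ENNReal_inv_le_mul_inv (ofReal_pow_ne_zero hCD 1) (ofReal_pow_ne_top 1) h4
  unfold poleKernel
  rw [div_eq_mul_inv, div_eq_mul_inv]
  calc _ ≤ 2 * edist x w * (ENNReal.ofReal CD ^ 1 * (μ (Metric.ball x (dist x w)))⁻¹) := by
        gcongr
    _ = _ := by ring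

/-- The kernel is almost constant at distances small compared with those to the poles. The
truncation becomes `2 * L` because `w` may leave the region where `z` lies. -/
lemma rieszKernel_le (h : IsDoublingMetricMeasureSpace μ CD) (hCD : 1 ≤ CD) {L : ℝ} {z w : X}
    (hL : 0 ≤ L) (hzw : dist z w < 4 * poleRadius ε x y z) :
    rieszKernel μ L x y z ≤ 2 * ENNReal.ofReal CD * rieszKernel μ (2 * L) x y w := by
  have hx : poleRadius ε x y z ≤ dist z x / 16 := poleRadius_le_left z
  have hy : poleRadius ε x y z ≤ dist z y / 16 := poleRadius_le_right z
  unfold rieszKernel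
  by_cases hz : z ∈ doubleBall L x y ∧ z ≠ x ∧ z ≠ y
  · have hw : w ∈ doubleBall (2 * L) x y ∧ w ≠ x ∧ w ≠ y := by
      refine ⟨?_, ?_, ?_⟩
      · have h1 := dist_triangle_left w x z
        have h2 := dist_triangle_left w y z
        have h3 : 0 ≤ L * dist x y := by positivity
        refine hz.1.imp (fun h => ?_) (fun h => ?_) <;>
        · rw [Metric.mem_ball] at h ⊢
          linarith
      · rintro rfl; linarith [dist_nonneg (x := z) (y := w)]
      · rintro rfl; linarith [dist_nonneg (x := z) (y := w)]
    rw [if_pos hz, if_pos hw, mul_add]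
    exact add_le_add (poleKernel_le h hCD hz.2.1 (by linarith))
      (poleKernel_le h hCD hz.2.2 (by linarith))
  · rw [if_neg hz]; exact zero_le

/-- The average of `F` over the ball `B_r(z)`. -/
noncomputable def ballAverage (μ : Measure X) (F : X → ℝ≥0∞) (r : ℝ) (z : X) : ℝ≥0∞ :=
  (∫⁻ w in Metric.ball z r, F w ∂μ) / μ (Metric.ball z r)

lemma exists_le_ballAverage (h : IsDoublingMetricMeasureSpace μ CD) {F : X → ℝ≥0∞}
    (hF : Measurable F) {r : ℝ} (hr : 0 < r) (z : X) :
    ∃ w, dist w z < r ∧ F w ≤ ballAverage μ F r z := by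
  obtain ⟨w, hw, hle⟩ := exists_le_setLAverage (μ := μ) (s := Metric.ball z r)
    (h.measure_ball_pos z hr).ne' (h.measure_ball_lt_top z r).ne hF.aemeasurable
  rw [setLAverage_eq] at hle
  exact ⟨w, hw, hle⟩

lemma ballAverage_le_of_subset {X : Type*} [MetricSpace X] [MeasurableSpace X]
    {μ : Measure X} {F : X → ℝ≥0∞} {p z : X} {r s : ℝ} {c : ℝ≥0∞} (hc : c ≠ 0)
    (hc' : c ≠ ∞) (hsub : Metric.ball p r ⊆ Metric.ball z s)
    (hm : μ (Metric.ball z s) ≤ c * μ (Metric.ball p r)) :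
    ballAverage μ F r p ≤ c * ballAverage μ F s z := by
  unfold ballAverage
  rw [div_eq_mul_inv, div_eq_mul_inv]
  calc _ ≤ (∫⁻ w in Metric.ball z s, F w ∂μ) * (c * (μ (Metric.ball z s))⁻¹) := by
        gcongr
        exact ENNReal_inv_le_mul_inv hc hc' hm
    _ = _ := by ring

/-- All Whitney balls meeting a small neighbourhood of `z` sit in one ball about `z` of comparable
mass. This bounds the supremum defining the cost on a whole neighbourhood, as `localLip` requires.
-/
lemma ballAverage_poleRadius_le (h : IsDoublingMetricMeasureSpace μ CD) (hCD : 1 ≤ CD)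
    {F : X → ℝ≥0∞} {p z w : X} (hp : dist p w < poleRadius ε x y p)
    (hz : dist w z < poleRadius ε x y z / 4) :
    ballAverage μ F (poleRadius ε x y p) p ≤
      ENNReal.ofReal CD ^ 3 * ballAverage μ F (4 * poleRadius ε x y z) z := by
  have h1 : poleRadius ε x y p ≤ poleRadius ε x y z + dist p z / 16 := poleRadius_le_add p z
  have h2 : poleRadius ε x y z ≤ poleRadius ε x y p + dist z p / 16 := poleRadius_le_add z p
  rw [dist_comm z p] at h2
  have h3 := dist_triangle p w z
  have h4 : 0 ≤ dist p w := dist_nonneg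
  refine ballAverage_le_of_subset (ofReal_pow_ne_zero hCD 3) (ofReal_pow_ne_top 3) ?_ ?_
  · exact Metric.ball_subset_ball' (by linarith)
  · exact h.measure_ball_le (by linarith) 3 (by linarith)

lemma measurable_measure_ball [SecondCountableTopology X] [SFinite μ] {r : X → ℝ}
    (hr : Continuous r) : Measurable fun z => μ (Metric.ball z (r z)) := by
  have : MeasurableSet {q : X × X | dist q.2 q.1 < r q.1} :=
    (isOpen_lt (by fun_prop) (by fun_prop)).measurableSet
  exact measurable_measure_prodMk_left this

/-- Averaging at the scale of the distance to the poles is bounded for the Riesz measures. -/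
lemma lintegral_ballAverage_le [SecondCountableTopology X]
    (h : IsDoublingMetricMeasureSpace μ CD) (hCD : 1 ≤ CD) {L : ℝ} (hL : 0 ≤ L) (hε : 0 < ε)
    {F : X → ℝ≥0∞} (hF : Measurable F) :
    ∫⁻ z, ballAverage μ F (4 * poleRadius ε x y z) z ∂(rieszMeasure μ L x y) ≤
      2 * ENNReal.ofReal CD ^ 3 * ∫⁻ w, F w ∂(rieszMeasure μ (2 * L) x y) := by
  have := h.isLocallyFiniteMeasure
  set ρ := poleRadius ε x y with hρ
  have hρc : Continuous ρ := continuous_poleRadius ε x y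
  set S : Set (X × X) := {q | dist q.2 q.1 < 4 * ρ q.1} with hS
  have hSm : MeasurableSet S := (isOpen_lt (by fun_prop) (by fun_prop)).measurableSet
  -- Tonelli: for fixed `w`, the centres `z` with `w ∈ B(z, 4ρ(z))` lie in `B(w, 6ρ(w))`, where
  -- kernel values and ball masses are comparable to those at `w`.
  set k : X → X → ℝ≥0∞ := fun z w => S.indicator (fun q => rieszKernel μ L x y q.1 *
    (μ (Metric.ball q.1 (4 * ρ q.1)))⁻¹ * F q.2) (z, w) with hk
  have hkm : Measurable (Function.uncurry k) := by
    refine Measurable.indicator ?_ hSm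
    have h1 : Measurable fun z => μ (Metric.ball z (4 * ρ z)) :=
      measurable_measure_ball (by fun_prop)
    exact (((measurable_rieszKernel μ L x y).comp measurable_fst).mul
      (h1.comp measurable_fst).inv).mul (hF.comp measurable_snd)
  have hleft : ∀ z, rieszKernel μ L x y z * ballAverage μ F (4 * ρ z) z = ∫⁻ w, k z w ∂μ := by
    intro z
    have h1 : ∀ w, k z w = rieszKernel μ L x y z * (μ (Metric.ball z (4 * ρ z)))⁻¹ *
        (Metric.ball z (4 * ρ z)).indicator F w := by
      intro w
      by_cases hw : dist w z < 4 * ρ z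
      · rw [hk, indicator_of_mem (show w ∈ Metric.ball z (4 * ρ z) from hw)]
        exact indicator_of_mem (show (z, w) ∈ S from hw) _
      · rw [hk, indicator_of_notMem (show w ∉ Metric.ball z (4 * ρ z) from hw), mul_zero]
        exact indicator_of_notMem (show (z, w) ∉ S from hw) _
    simp_rw [h1]
    rw [lintegral_const_mul _ (hF.indicator Metric.isOpen_ball.measurableSet),
      lintegral_indicator Metric.isOpen_ball.measurableSet, ballAverage, div_eq_mul_inv]
    ring
  have hright : ∀ w, ∫⁻ z, k z w ∂μ ≤
      2 * ENNReal.ofReal CD ^ 3 * (rieszKernel μ (2 * L) x y w * F w) := by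
    intro w
    -- A pole belongs to no Whitney ball.
    by_cases hw : w = x ∨ w = y
    · have h0 : ∀ z, k z w = 0 := by
        intro z
        refine indicator_of_notMem (fun hz => ?_) _
        have hz' : dist w z < 4 * ρ z := hz
        have hx : ρ z ≤ dist z x / 16 := poleRadius_le_left z
        have hy : ρ z ≤ dist z y / 16 := poleRadius_le_right z
        rw [dist_comm] at hz'
        rcases hw with rfl | rfl <;> linarith [dist_nonneg (x := z) (y := w)]
      simp [h0]
    push Not at hw
    have hρw : 0 < ρ w := poleRadius_pos hε hw.1 hw.2
    set m := μ (Metric.ball w (6 * ρ w)) with hm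
    have hm0 : m ≠ 0 := (h.measure_ball_pos w (by positivity)).ne'
    have hmt : m ≠ ∞ := (h.measure_ball_lt_top w _).ne
    have hb : ∀ z, k z w ≤ (Metric.ball w (6 * ρ w)).indicator
        (fun _ => 2 * ENNReal.ofReal CD * rieszKernel μ (2 * L) x y w *
          (ENNReal.ofReal CD ^ 2 * m⁻¹) * F w) z := by
      intro z
      by_cases hz : dist w z < 4 * ρ z
      · have h1 : ρ z ≤ ρ w + dist z w / 16 := poleRadius_le_add z w
        have h2 : ρ w ≤ ρ z + dist w z / 16 := poleRadius_le_add w z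
        rw [dist_comm z w] at h1
        have hzm : z ∈ Metric.ball w (6 * ρ w) := by
          rw [Metric.mem_ball, dist_comm]; linarith
        have hkz : k z w = rieszKernel μ L x y z * (μ (Metric.ball z (4 * ρ z)))⁻¹ * F w :=
          indicator_of_mem (show (z, w) ∈ S from hz) _
        rw [hkz, indicator_of_mem hzm]
        gcongr
        · exact rieszKernel_le h hCD hL (by rw [dist_comm]; exact hz)
        · refine ENNReal_inv_le_mul_inv (ofReal_pow_ne_zero hCD 2) (ofReal_pow_ne_top 2) ?_
          refine h.measure_ball_le (by linarith [dist_nonneg (x := w) (y := z)]) 2 ?_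
          rw [dist_comm z w]; linarith
      · have hkz : k z w = 0 := indicator_of_notMem (show (z, w) ∉ S from hz) _
        rw [hkz]; exact zero_le
    calc _ ≤ _ := lintegral_mono hb
      _ = 2 * ENNReal.ofReal CD * rieszKernel μ (2 * L) x y w *
          (ENNReal.ofReal CD ^ 2 * m⁻¹) * F w * m := by
        rw [lintegral_indicator Metric.isOpen_ball.measurableSet, setLIntegral_const]
      _ = 2 * ENNReal.ofReal CD ^ 3 * (rieszKernel μ (2 * L) x y w * F w) * (m⁻¹ * m) := by ring
      _ = _ := by rw [ENNReal.inv_mul_cancel hm0 hmt, mul_one]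
  unfold rieszMeasure
  calc _ ≤ ∫⁻ z, rieszKernel μ L x y z * ballAverage μ F (4 * ρ z) z ∂μ :=
        lintegral_withDensity_le_lintegral_mul μ (measurable_rieszKernel μ L x y) _
    _ = ∫⁻ z, ∫⁻ w, k z w ∂μ ∂μ := lintegral_congr hleft
    _ = ∫⁻ w, ∫⁻ z, k z w ∂μ ∂μ := lintegral_lintegral_swap hkm.aemeasurable
    _ ≤ ∫⁻ w, 2 * ENNReal.ofReal CD ^ 3 * (rieszKernel μ (2 * L) x y w * F w) ∂μ :=
        lintegral_mono hright
    _ = _ := by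
      rw [lintegral_const_mul (f := fun w => rieszKernel μ (2 * L) x y w * F w) _
          ((measurable_rieszKernel μ _ x y).mul hF),
        lintegral_withDensity_eq_lintegral_mul _ (measurable_rieszKernel μ _ x y) hF]
      rfl

/-- Near a pole, the averages over Whitney-type balls are controlled by the Riesz measure of a small
ball centred at the pole. -/
lemma mul_ballAverage_le (h : IsDoublingMetricMeasureSpace μ CD) {L s : ℝ}
    (hL : 1 ≤ L) (hs : 0 < s) (hsε : 4 * s ≤ ε) (hsd : 4 * s ≤ dist x y) {F : X → ℝ≥0∞}
    (hF : Measurable F) {a p : X} (ha : a = x ∨ a = y) (hpx : s ≤ dist p x) (hpy : s ≤ dist p y)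
    (hpa : dist p a ≤ 2 * s) :
    ENNReal.ofReal s * ballAverage μ F (poleRadius ε x y p) p ≤
      2 * ENNReal.ofReal CD ^ 7 * ∫⁻ w in Metric.ball a (3 * s), F w ∂(rieszMeasure μ L x y) := by
  set r := poleRadius ε x y p with hr
  have hr0 : s / 16 ≤ r := le_poleRadius (by linarith) hpx hpy
  have hrx : r ≤ dist p x / 16 := poleRadius_le_left p
  have hry : r ≤ dist p y / 16 := poleRadius_le_right p
  have hra : r ≤ dist p a / 16 := by rcases ha with rfl | rfl <;> assumption
  have hsa : s ≤ dist p a := by rcases ha with rfl | rfl <;> assumption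
  set m := μ (Metric.ball a (3 * s)) with hm
  have hm0 : m ≠ 0 := (h.measure_ball_pos a (by positivity)).ne'
  have hmt : m ≠ ∞ := (h.measure_ball_lt_top a _).ne
  set n := μ (Metric.ball p r) with hn
  have hn0 : n ≠ 0 := (h.measure_ball_pos p (by linarith)).ne'
  have hnt : n ≠ ∞ := (h.measure_ball_lt_top p _).ne
  -- Seven doublings, because `3s + d(p,a) ≤ 5s ≤ 2⁷ · s / 16` and `r ≥ s / 16`.
  have hmn : m ≤ ENNReal.ofReal CD ^ 7 * n :=
    h.measure_ball_le (by linarith) 7 (by norm_num; linarith)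
  have hsub : Metric.ball p r ⊆ Metric.ball a (3 * s) := Metric.ball_subset_ball' (by linarith)
  have hker : ∀ w ∈ Metric.ball p r, ENNReal.ofReal (s / 2) / m ≤ rieszKernel μ L x y w := by
    intro w hw
    have hwp : dist p w < r := by rw [dist_comm]; exact hw
    have hwx := dist_triangle p w x
    have hwy := dist_triangle p w y
    have hwa := dist_triangle p w a
    have hwa3 : dist w a < 3 * s := hsub hw
    have hwne : w ≠ x ∧ w ≠ y := by
      constructor
      · rintro rfl; linarith [dist_nonneg (x := p) (y := w)]
      · rintro rfl; linarith [dist_nonneg (x := p) (y := w)]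
    have hwL : w ∈ doubleBall L x y := by
      have h3 : dist x y ≤ L * dist x y := le_mul_of_one_le_left dist_nonneg hL
      rcases ha with rfl | rfl
      · exact Or.inl (Metric.mem_ball.2 (by linarith))
      · exact Or.inr (Metric.mem_ball.2 (by linarith))
    have hpole : ENNReal.ofReal (s / 2) / m ≤ poleKernel μ a w := by
      unfold poleKernel
      rw [edist_dist]
      rw [dist_comm] at hwa3
      rw [dist_comm w a] at hwa
      gcongr
      · linarith
      · exact measure_mono (Metric.ball_subset_ball hwa3.le)
    refine hpole.trans ?_
    unfold rieszKernel
    rw [if_pos ⟨hwL, hwne⟩]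
    rcases ha with rfl | rfl
    · exact le_self_add
    · exact le_add_self
  have hint : ENNReal.ofReal (s / 2) / m * ∫⁻ w in Metric.ball p r, F w ∂μ ≤
      ∫⁻ w in Metric.ball a (3 * s), F w ∂(rieszMeasure μ L x y) := by
    calc _ = ∫⁻ w in Metric.ball p r, ENNReal.ofReal (s / 2) / m * F w ∂μ :=
          (lintegral_const_mul _ hF).symm
      _ ≤ ∫⁻ w in Metric.ball p r, rieszKernel μ L x y w * F w ∂μ := by
          refine setLIntegral_mono' Metric.isOpen_ball.measurableSet fun w hw => ?_
          gcongr
          exact hker w hw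
      _ = ∫⁻ w in Metric.ball p r, F w ∂(rieszMeasure μ L x y) := by
          unfold rieszMeasure
          rw [restrict_withDensity Metric.isOpen_ball.measurableSet,
            lintegral_withDensity_eq_lintegral_mul _ (measurable_rieszKernel μ _ x y) hF]
          rfl
      _ ≤ _ := lintegral_mono_set hsub
  have h2 : ENNReal.ofReal s = 2 * ENNReal.ofReal (s / 2) := by
    rw [← ENNReal.ofReal_ofNat, ← ENNReal.ofReal_mul (by norm_num)]
    congr 1; ring
  set J := ∫⁻ w in Metric.ball p r, F w ∂μ with hJ
  calc _ = 2 * (ENNReal.ofReal (s / 2) * J * n⁻¹) * (m⁻¹ * m) := by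
        have hb : ballAverage μ F r p = J * n⁻¹ := div_eq_mul_inv _ _
        rw [ENNReal.inv_mul_cancel hm0 hmt, h2, hb]; ring
    _ = 2 * (ENNReal.ofReal (s / 2) / m * J) * (m * n⁻¹) := by
        rw [div_eq_mul_inv _ m]; ring
    _ ≤ 2 * (∫⁻ w in Metric.ball a (3 * s), F w ∂(rieszMeasure μ L x y)) *
        (ENNReal.ofReal CD ^ 7 * n * n⁻¹) := by gcongr
    _ = _ := by rw [mul_assoc (ENNReal.ofReal CD ^ 7), ENNReal.mul_inv_cancel hn0 hnt]; ring

lemma rieszMeasure_singleton (μ : Measure X) (L : ℝ) {a : X} (ha : a = x ∨ a = y) :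
    rieszMeasure μ L x y {a} = 0 := by
  unfold rieszMeasure
  rw [withDensity_apply _ (measurableSet_singleton a)]
  have h0 : ∀ z ∈ ({a} : Set X), rieszKernel μ L x y z = 0 := by
    rintro z rfl
    unfold rieszKernel
    rw [if_neg]
    rintro ⟨_, h1, h2⟩
    exact ha.elim h1 h2
  rw [setLIntegral_congr_fun (measurableSet_singleton a) h0]
  simp

end Averages

/-! ### From the Lipschitz estimate to chains. -/

section LipToChain

variable {X : Type*} [MetricSpace X] [MeasurableSpace X] [BorelSpace X]
  {μ : Measure X} {CD : ℝ} {x y : X}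

/-- Continuity from above of the finite measure `F ν`, which does not charge `a`. It makes the
contribution of the chain ends near the poles negligible. -/
lemma tendsto_setLIntegral_ball_zero {ν : Measure X} {a : X} (ha : ν {a} = 0) {F : X → ℝ≥0∞}
    (hF : ∫⁻ z, F z ∂ν ≠ ∞) :
    Tendsto (fun s : ℝ => ∫⁻ z in Metric.ball a (3 * s), F z ∂ν) (𝓝[>] 0) (𝓝 0) := by
  have hfin : IsFiniteMeasure (ν.withDensity F) := isFiniteMeasure_withDensity hF
  have h1 : Tendsto (fun s : ℝ => ν.withDensity F (Metric.ball a (3 * s))) (𝓝[>] 0)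
      (𝓝 (ν.withDensity F (⋂ s > (0 : ℝ), Metric.ball a (3 * s)))) := by
    refine tendsto_measure_biInter_gt (fun s _ => Metric.isOpen_ball.nullMeasurableSet)
      (fun i j _ hij => Metric.ball_subset_ball (by linarith)) ⟨1, one_pos, measure_ne_top _ _⟩
  have h2 : (⋂ s > (0 : ℝ), Metric.ball a (3 * s)) = {a} := by
    ext z
    simp only [mem_iInter, Metric.mem_ball, mem_singleton_iff]
    constructor
    · intro h
      by_contra hne
      have h3 := dist_pos.2 hne
      have := h (dist z a / 3) (by positivity)
      linarith
    · rintro rfl s hs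
      simpa using hs
  have h3 : ν.withDensity F {a} = 0 := withDensity_absolutelyContinuous ν F ha
  rw [h2, h3] at h1
  refine h1.congr fun s => ?_
  rw [withDensity_apply _ Metric.isOpen_ball.measurableSet]

open Classical in
/-- The dominating function in the energy estimate: an average at the scale of the distance to the
poles. -/
noncomputable def dominatingFun (μ : Measure X) (p a ε : ℝ) (x y : X) (F : X → ℝ≥0∞) (z : X) :
    ℝ≥0∞ :=
  -- The radius vanishes at the poles, so averages there say nothing about nearby points; `∞` is a
  -- trivial bound, harmless because the poles are null.
  if z = x ∨ z = y then ∞ else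
    (ENNReal.ofReal a ^ 3 * ballAverage μ F (4 * poleRadius ε x y z) z) ^ (1 / p)

lemma lintegral_dominatingFun_le [SecondCountableTopology X]
    (h : IsDoublingMetricMeasureSpace μ CD) (hCD : 1 ≤ CD) {p L ε : ℝ} (hp : 0 < p) (hL : 0 ≤ L)
    (hε : 0 < ε) {F : X → ℝ≥0∞} (hF : Measurable F) :
    ∫⁻ z, dominatingFun μ p CD ε x y F z ^ p ∂(rieszMeasure μ L x y) ≤
      2 * ENNReal.ofReal CD ^ 6 * ∫⁻ w, F w ∂(rieszMeasure μ (2 * L) x y) := by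
  have hae : ∀ᵐ z ∂(rieszMeasure μ L x y), dominatingFun μ p CD ε x y F z ^ p =
      ENNReal.ofReal CD ^ 3 * ballAverage μ F (4 * poleRadius ε x y z) z := by
    have h1 : ∀ᵐ z ∂(rieszMeasure μ L x y), z ∉ ({x} : Set X) :=
      measure_eq_zero_iff_ae_notMem.1 (rieszMeasure_singleton μ L (Or.inl rfl))
    have h2 : ∀ᵐ z ∂(rieszMeasure μ L x y), z ∉ ({y} : Set X) :=
      measure_eq_zero_iff_ae_notMem.1 (rieszMeasure_singleton μ L (Or.inr rfl))
    filter_upwards [h1, h2] with z hz1 hz2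
    unfold dominatingFun
    rw [if_neg (by rintro (h | h) <;> simp_all), ← ENNReal.rpow_mul, one_div,
      inv_mul_cancel₀ hp.ne', ENNReal.rpow_one]
  rw [lintegral_congr_ae hae, lintegral_const_mul' _ _ (ofReal_pow_ne_top 3)]
  calc _ ≤ ENNReal.ofReal CD ^ 3 * (2 * ENNReal.ofReal CD ^ 3 *
        ∫⁻ w, F w ∂(rieszMeasure μ (2 * L) x y)) := by
        gcongr
        exact lintegral_ballAverage_le h hCD hL hε hF
    _ = _ := by ring

lemma eventually_ofReal_mul_le {a β : ℝ≥0∞} (ha : a ≠ ∞) (hβ : 0 < β) :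
    ∀ᶠ s : ℝ in 𝓝[>] 0, ENNReal.ofReal s * a ≤ β := by
  have h1 : Tendsto (fun s : ℝ => ENNReal.ofReal s * a) (𝓝[>] 0) (𝓝 (ENNReal.ofReal 0 * a)) :=
    (ENNReal.Tendsto.mul_const (ENNReal.continuous_ofReal.tendsto 0) (Or.inr ha)).mono_left
      nhdsWithin_le_nhds
  rw [ENNReal.ofReal_zero, zero_mul] at h1
  exact (h1.eventually (gt_mem_nhds hβ)).mono fun s hs => hs.le

/-- The pointwise estimate for Lipschitz functions produces chains with controlled integral. -/
lemma LipEstimate.exists_pointChain [SecondCountableTopology X]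
    (h : IsDoublingMetricMeasureSpace μ CD) (hCD : 1 ≤ CD) {p C L : ℝ} (hp : 1 ≤ p) (hL : 1 ≤ L)
    (hxy : x ≠ y) (hE : LipEstimate μ p x y C L) {f : X → ℝ≥0∞} (hf : Measurable f)
    (hfx : f x < ∞) (hfy : f y < ∞) (hI : ∫⁻ z, f z ^ p ∂(rieszMeasure μ (2 * L) x y) ≠ ∞)
    {B β : ℝ≥0∞} (hB : B ≠ ∞) (hβ : 0 < β)
    (hlt : ENNReal.ofReal C * edist x y ^ (p - 1) * (2 * ENNReal.ofReal CD ^ 6 *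
      ∫⁻ z, f z ^ p ∂(rieszMeasure μ (2 * L) x y)) < B ^ p) {ε : ℝ} (hε : 0 < ε) :
    ∃ c : PointChain X, c.IsEpsChain ε ∧ c.first = x ∧ c.last = y ∧
      c.integral f ≤ 10 * B + 5 * β := by
  have hp0 : 0 < p := zero_lt_one.trans_le hp
  have hd : 0 < dist x y := dist_pos.2 hxy
  set F : X → ℝ≥0∞ := fun z => f z ^ p with hFdef
  have hF : Measurable F := hf.pow_const p
  set ν := rieszMeasure μ (2 * L) x y with hν
  have hedge : ∀ a, (a = x ∨ a = y) → ∀ᶠ s : ℝ in 𝓝[>] 0,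
      2 * ENNReal.ofReal CD ^ 7 * ∫⁻ z in Metric.ball a (3 * s), F z ∂ν ≤ β ^ p := by
    intro a ha
    have h1 := tendsto_setLIntegral_ball_zero (rieszMeasure_singleton μ (2 * L) ha) hI
    have h2 := ENNReal.Tendsto.const_mul (a := 2 * ENNReal.ofReal CD ^ 7) h1
      (Or.inr (ENNReal.mul_ne_top (by simp) (ofReal_pow_ne_top 7)))
    rw [mul_zero] at h2
    exact (h2.eventually (gt_mem_nhds (ENNReal.rpow_pos_of_nonneg hβ hp0.le))).mono
      fun s hs => hs.le
  have hpos : ∀ᶠ s : ℝ in 𝓝[>] 0, 0 < s := eventually_mem_nhdsWithin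
  have hsmall : ∀ b : ℝ, 0 < b → ∀ᶠ s : ℝ in 𝓝[>] 0, s < b := fun b hb =>
    nhdsWithin_le_nhds (gt_mem_nhds hb)
  -- The scale `s` is so small that everything within `3s` of a pole contributes at most `β`.
  obtain ⟨s, hs, hs1, hsε, hsd, hβx, hβy, hex, hey⟩ := (hpos.and ((hsmall 1 one_pos).and
    ((hsmall (ε / 4) (by positivity)).and ((hsmall (dist x y / 4) (by positivity)).and
    ((eventually_ofReal_mul_le hfx.ne hβ).and ((eventually_ofReal_mul_le hfy.ne hβ).and
    ((hedge x (Or.inl rfl)).and (hedge y (Or.inr rfl))))))))).exists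
  set ρ := poleRadius ε x y with hρ
  set A : X → ℝ≥0∞ := fun p' => ballAverage μ F (ρ p') p' ^ (1 / p) with hA
  have hApow : ∀ q, A q ^ p = ballAverage μ F (ρ q) q := fun q => by
    rw [hA, ← ENNReal.rpow_mul, one_div, inv_mul_cancel₀ hp0.ne', ENNReal.rpow_one]
  obtain ⟨M, hM⟩ : ∃ M : NNReal, B < M * ENNReal.ofReal (s / 32) := by
    obtain ⟨M, hM⟩ := ENNReal.lt_iff_exists_nnreal_btwn.1
      (ENNReal.div_lt_top (y := ENNReal.ofReal (s / 32)) hB (by simp; linarith))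
    refine ⟨M, ?_⟩
    exact (ENNReal.div_lt_iff (Or.inl (by simp; linarith)) (Or.inl ENNReal.ofReal_ne_top)).1 hM.1
  classical
  set W : Set X := {w | s ≤ dist w x ∧ s ≤ dist w y} with hW
  -- The truncation at `M` makes the chain function Lipschitz. Within `s` of a pole the cost may be
  -- `0`, since the coarsening asks nothing of `G` there.
  set G : X → ℝ≥0∞ := fun w => if w ∈ W then
    min M (⨆ (q : X) (_ : dist q w < ρ q), A q) else 0 with hG
  have hGM : ∀ w, G w ≤ M := by
    intro w
    rw [hG]; dsimp only
    split_ifs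
    · exact min_le_left _ _
    · exact zero_le
  have hφ : ∀ q, ∃ w, s ≤ dist q x → s ≤ dist q y → dist w q < ρ q ∧ f w ≤ A q := by
    intro q
    by_cases hq : s ≤ dist q x ∧ s ≤ dist q y
    · have hρ0 : s / 16 ≤ ρ q := le_poleRadius (by linarith) hq.1 hq.2
      obtain ⟨w, hw1, hw2⟩ := exists_le_ballAverage h hF (by linarith : 0 < ρ q) q
      refine ⟨w, fun _ _ => ⟨hw1, ?_⟩⟩
      rw [hA, ← ENNReal.rpow_le_rpow_iff hp0]
      exact hw2.trans (hApow q).ge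
    · exact ⟨q, fun h1 h2 => absurd ⟨h1, h2⟩ hq⟩
  choose φ hφ using hφ
  have hdom : ∀ z, ∃ δ > 0, ∀ w ∈ Metric.ball z δ, G w ≤ dominatingFun μ p CD ε x y F z := by
    intro z
    unfold dominatingFun
    by_cases hz : z = x ∨ z = y
    · exact ⟨1, one_pos, fun w _ => by rw [if_pos hz]; exact le_top⟩
    rw [if_neg hz]
    push Not at hz
    have hρz : 0 < ρ z := poleRadius_pos hε hz.1 hz.2
    refine ⟨ρ z / 4, by positivity, fun w hw => ?_⟩
    rw [hG]; dsimp only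
    split_ifs
    · refine (min_le_right _ _).trans (iSup₂_le fun q hq => ?_)
      rw [hA]; dsimp only
      gcongr
      exact ballAverage_poleRadius_le h hCD hq hw
    · exact zero_le
  have hinf := hE.chainCostInf_rpow_le hp0 (by positivity : 0 < s / 64) hGM hdom
  have hen : rieszEnergy μ p C L x y (dominatingFun μ p CD ε x y F) < B ^ p := by
    refine lt_of_le_of_lt ?_ hlt
    unfold rieszEnergy
    gcongr
    exact lintegral_dominatingFun_le h hCD hp0 (by linarith) hε hF
  obtain ⟨t, htB, ht⟩ := exists_chainCost_lt ((ENNReal.rpow_lt_rpow_iff hp0).1 (hinf.trans_lt hen))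
  have hβ' : ∀ q, s ≤ dist q x → s ≤ dist q y → (dist q x ≤ 2 * s ∨ dist q y ≤ 2 * s) →
      ENNReal.ofReal s * A q ≤ β := by
    intro q hqx hqy hq
    have h1 : ENNReal.ofReal s * ballAverage μ F (ρ q) q ≤ β ^ p := by
      rcases hq with hq | hq
      · exact (mul_ballAverage_le h (by linarith) hs (by linarith) (by linarith) hF (Or.inl rfl)
          hqx hqy hq).trans hex
      · exact (mul_ballAverage_le h (by linarith) hs (by linarith) (by linarith) hF (Or.inr rfl)
          hqx hqy hq).trans hey
    -- Since `s ≤ 1` and `p ≥ 1`, `(s A)^p ≤ s A^p`, which the pole estimate bounds by `β ^ p`.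
    rw [← ENNReal.rpow_le_rpow_iff hp0, ENNReal.mul_rpow_of_nonneg _ _ hp0.le, hApow]
    refine le_trans ?_ h1
    gcongr
    have : ENNReal.ofReal s ≤ 1 := by simpa using hs1.le
    simpa using ENNReal.rpow_le_rpow_of_exponent_ge this hp
  obtain ⟨τ, hτ, hτle⟩ := ht.exists_coarse (f := f) (A := A) (φ := φ) (M := M) (B := B) (β := β) hs
    (by linarith) (by linarith) le_rfl hφ
    (fun q w _ _ hwx hwy hqw => by
      rw [hG]; dsimp only
      rw [if_pos ⟨hwx, hwy⟩]
      exact min_le_min le_rfl (le_iSup₂_of_le q hqw le_rfl))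
    hM hβ' hβx hβy htB.le
  obtain ⟨c, h1, h2, h3, h4⟩ := hτ.exists_pointChain
  refine ⟨c, h1, h2, h3, ?_⟩
  rw [h4]
  refine hτle.trans ?_
  gcongr

end LipToChain

/-! ### Control of length and integral together. -/

section ChainEstimate

variable {X : Type*} [MetricSpace X] [MeasurableSpace X] [BorelSpace X]
  {μ : Measure X} {CD : ℝ} {x y : X}

lemma lintegral_add_const_rpow_le (h : IsDoublingMetricMeasureSpace μ CD)
    {p L : ℝ} (hp : 1 ≤ p) (hL : 1 ≤ L) (hxy : x ≠ y) {g : X → ℝ≥0∞} (hg : Measurable g)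
    {l : ℝ≥0∞} (hl : ∫⁻ z, g z ^ p ∂(rieszMeasure μ L x y) ≤ l ^ p * edist x y) :
    ∫⁻ z, (g z + l) ^ p ∂(rieszMeasure μ L x y) ≤
      2 ^ (p - 1) * (1 + ENNReal.ofReal (8 * CD * L)) * l ^ p * edist x y := by
  calc _ ≤ ∫⁻ z, 2 ^ (p - 1) * (g z ^ p + l ^ p) ∂(rieszMeasure μ L x y) :=
        lintegral_mono fun z => ENNReal.rpow_add_le_mul_rpow_add_rpow _ _ hp
    _ = 2 ^ (p - 1) * (∫⁻ z, g z ^ p ∂(rieszMeasure μ L x y) +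
        l ^ p * rieszMeasure μ L x y univ) := by
      rw [lintegral_const_mul _ ((hg.pow_const p).add_const _), lintegral_add_left (hg.pow_const p),
        lintegral_const]
    _ ≤ 2 ^ (p - 1) * (l ^ p * edist x y + l ^ p *
        (ENNReal.ofReal (8 * CD * L) * edist x y)) := by
      gcongr
      exact rieszMeasure_univ_le h hL hxy
    _ = _ := by ring

/-- The constant in the bound of the integrals along chains. -/
noncomputable def chainConst (p CD C L : ℝ) : ℝ :=
  10 * (C * (2 * CD ^ 6) * (2 ^ (p - 1) * (1 + 8 * CD * (2 * L))) + 1) ^ (1 / p) + 5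

lemma one_le_chainConst {p CD C L : ℝ} (hCD : 1 ≤ CD) (hC : 0 < C) (hL : 1 ≤ L) :
    1 ≤ chainConst p CD C L := by
  unfold chainConst
  have : 0 ≤ (C * (2 * CD ^ 6) * (2 ^ (p - 1) * (1 + 8 * CD * (2 * L))) + 1) ^ (1 / p) := by
    positivity
  linarith

lemma edist_rpow_sub_one_mul {X : Type*} [MetricSpace X] {x y : X} (hxy : x ≠ y) (p : ℝ) :
    edist x y ^ (p - 1) * edist x y = edist x y ^ p := by
  rw [ENNReal.rpow_sub _ _ (by simpa [edist_eq_zero] using hxy) (edist_ne_top _ _),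
    ENNReal.rpow_one, ENNReal.div_mul_cancel (by simpa [edist_eq_zero] using hxy)
    (edist_ne_top _ _)]

/-- The mass of the Riesz measure is of order `d(x,y)`, so adding `l` changes the energy only by a
constant factor. A chain bound for `g + l` then controls both the integral of `g` and `l` times the
length. -/
lemma LipEstimate.exists_pointChain_add_const [SecondCountableTopology X]
    (h : IsDoublingMetricMeasureSpace μ CD) (hCD : 1 ≤ CD) {p C L : ℝ} (hp : 1 ≤ p) (hC : 0 < C)
    (hL : 1 ≤ L) (hxy : x ≠ y) (hE : LipEstimate μ p x y C L) {g : X → ℝ≥0∞} (hg : Measurable g)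
    (hgx : g x < ∞) (hgy : g y < ∞) {l : ℝ≥0∞} (hl0 : l ≠ 0) (hlt : l ≠ ∞)
    (hl : ∫⁻ z, g z ^ p ∂(rieszMeasure μ (2 * L) x y) ≤ l ^ p * edist x y)
    {ε : ℝ} (hε : 0 < ε) :
    ∃ c : PointChain X, c.IsEpsChain ε ∧ c.first = x ∧ c.last = y ∧
      c.integral (fun z => g z + l) ≤ ENNReal.ofReal (chainConst p CD C L) * l * edist x y := by
  have hp0 : 0 < p := zero_lt_one.trans_le hp
  have hd0 : edist x y ≠ 0 := by simpa [edist_eq_zero] using hxy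
  have hdt : edist x y ≠ ∞ := edist_ne_top x y
  -- The final `+ 1` makes the energy strictly smaller than `B ^ p`, as needed to extract a chain
  -- from an infimum.
  set K : ℝ := C * (2 * CD ^ 6) * (2 ^ (p - 1) * (1 + 8 * CD * (2 * L))) + 1 with hK
  have hK0 : 0 < K := by positivity
  have hI := lintegral_add_const_rpow_le h hp (by linarith : 1 ≤ 2 * L) hxy hg hl
  have hlp0 : l ^ p ≠ 0 := (ENNReal.rpow_pos (pos_iff_ne_zero.2 hl0) hlt).ne'
  have hlpt : l ^ p ≠ ∞ := ENNReal.rpow_ne_top_of_nonneg hp0.le hlt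
  have hI' : ∫⁻ z, (g z + l) ^ p ∂(rieszMeasure μ (2 * L) x y) ≠ ∞ := by
    refine (hI.trans_lt ?_).ne
    refine ENNReal.mul_lt_top (ENNReal.mul_lt_top (ENNReal.mul_lt_top ?_ ?_)
      (lt_top_iff_ne_top.2 hlpt)) (lt_top_iff_ne_top.2 hdt)
    · exact ENNReal.rpow_lt_top_of_nonneg (by linarith) (by simp)
    · exact ENNReal.add_lt_top.2 ⟨by simp, ENNReal.ofReal_lt_top⟩
  set B : ℝ≥0∞ := ENNReal.ofReal (K ^ (1 / p)) * (l * edist x y) with hB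
  have hBp : B ^ p = ENNReal.ofReal K * (l ^ p * edist x y ^ p) := by
    rw [hB, ENNReal.mul_rpow_of_nonneg _ _ hp0.le, ENNReal.mul_rpow_of_nonneg _ _ hp0.le,
      ENNReal.ofReal_rpow_of_nonneg (by positivity) hp0.le, ← Real.rpow_mul hK0.le, one_div,
      inv_mul_cancel₀ hp0.ne', Real.rpow_one]
  have hlt' : ENNReal.ofReal C * edist x y ^ (p - 1) * (2 * ENNReal.ofReal CD ^ 6 *
      ∫⁻ z, (g z + l) ^ p ∂(rieszMeasure μ (2 * L) x y)) < B ^ p := by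
    calc _ ≤ ENNReal.ofReal C * edist x y ^ (p - 1) * (2 * ENNReal.ofReal CD ^ 6 *
          (2 ^ (p - 1) * (1 + ENNReal.ofReal (8 * CD * (2 * L))) * l ^ p * edist x y)) := by gcongr
      _ = ENNReal.ofReal C * (2 * ENNReal.ofReal CD ^ 6) *
          (2 ^ (p - 1) * (1 + ENNReal.ofReal (8 * CD * (2 * L)))) *
          (l ^ p * (edist x y ^ (p - 1) * edist x y)) := by ring
      _ = ENNReal.ofReal (K - 1) * (l ^ p * edist x y ^ p) := by
        have hq : 0 ≤ 8 * CD * (2 * L) := by positivity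
        rw [edist_rpow_sub_one_mul hxy, hK, add_sub_cancel_right]
        generalize 8 * CD * (2 * L) = q at hq ⊢
        rw [ENNReal.ofReal_mul (by positivity), ENNReal.ofReal_mul (by positivity),
          ENNReal.ofReal_mul (by positivity), ENNReal.ofReal_mul (by positivity),
          ENNReal.ofReal_add (by positivity) (by positivity), ENNReal.ofReal_pow (by positivity),
          ← ENNReal.ofReal_rpow_of_pos (by positivity), ENNReal.ofReal_ofNat, ENNReal.ofReal_one]
      _ < ENNReal.ofReal K * (l ^ p * edist x y ^ p) := by
        refine ENNReal.mul_lt_mul_left ?_ ?_ ?_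
        · exact mul_ne_zero hlp0
            (ENNReal.rpow_pos (pos_iff_ne_zero.2 hd0) hdt).ne'
        · exact ENNReal.mul_ne_top hlpt (edist_rpow_ne_top x y hp0.le)
        · exact (ENNReal.ofReal_lt_ofReal_iff hK0).2 (by linarith)
      _ = _ := hBp.symm
  obtain ⟨c, h1, h2, h3, h4⟩ := hE.exists_pointChain h hCD hp hL hxy (hg.add_const l)
    (ENNReal.add_lt_top.2 ⟨hgx, lt_top_iff_ne_top.2 hlt⟩)
    (ENNReal.add_lt_top.2 ⟨hgy, lt_top_iff_ne_top.2 hlt⟩) hI'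
    (ENNReal.mul_ne_top ENNReal.ofReal_ne_top (ENNReal.mul_ne_top hlt hdt) : B ≠ ∞)
    (pos_iff_ne_zero.2 (mul_ne_zero hl0 hd0) : 0 < l * edist x y) hlt' hε
  refine ⟨c, h1, h2, h3, h4.trans (le_of_eq ?_)⟩
  have hcc : ENNReal.ofReal (chainConst p CD C L) = 10 * ENNReal.ofReal (K ^ (1 / p)) + 5 := by
    unfold chainConst
    rw [← hK, ENNReal.ofReal_add (by positivity) (by positivity),
      ENNReal.ofReal_mul (by positivity), ENNReal.ofReal_ofNat, ENNReal.ofReal_ofNat]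
  rw [hcc]
  ring

/-- The pointwise estimate for Lipschitz functions implies the existence of good chains. -/
lemma LipEstimate.chainConnectivity [SecondCountableTopology X]
    (h : IsDoublingMetricMeasureSpace μ CD) (hCD : 1 ≤ CD) {p C L : ℝ} (hp : 1 ≤ p) (hC : 0 < C)
    (hL : 1 ≤ L) (hE : LipEstimate μ p x y C L) :
    ChainConnectivity μ p x y (chainConst p CD C L ^ p) (2 * L) := by
  have hp0 : 0 < p := zero_lt_one.trans_le hp
  set K := chainConst p CD C L with hK
  have hK1 : 1 ≤ K := one_le_chainConst hCD hC hL
  have hK0 : 0 < K := zero_lt_one.trans_le hK1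
  refine chainConnectivity_of_chainInf_le fun g hg hgx hgy ε hε => ?_
  rcases eq_or_ne x y with rfl | hxy
  · refine (iInf₂_le (PointChain.single x) ⟨fun i => i.elim0, rfl, rfl, ?_⟩).trans ?_
    · rw [PointChain.single_integral, ENNReal.zero_rpow_of_pos hp0]; exact zero_le
    · rw [PointChain.single_length]; exact zero_le
  have hd0 : edist x y ≠ 0 := by simpa [edist_eq_zero] using hxy
  have hdt : edist x y ≠ ∞ := edist_ne_top x y
  set E := ∫⁻ z, g z ^ p ∂(rieszMeasure μ (2 * L) x y) with hEdef
  have hKp : ENNReal.ofReal K ^ p = ENNReal.ofReal (K ^ p) := ENNReal.ofReal_rpow_of_pos hK0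
  rcases eq_or_ne E ∞ with hEt | hEt
  · have : rieszEnergy μ p (K ^ p) (2 * L) x y g = ∞ := by
      unfold rieszEnergy
      rw [← hEdef, hEt, ENNReal.mul_top]
      refine mul_ne_zero ?_ (ENNReal.rpow_pos (pos_iff_ne_zero.2 hd0) hdt).ne'
      simpa using Real.rpow_pos_of_pos hK0 p
    rw [this]; exact le_top
  set l₀ : ℝ≥0∞ := (E / edist x y) ^ (1 / p) with hl₀
  have hl₀p : l₀ ^ p = E / edist x y := by
    rw [hl₀, ← ENNReal.rpow_mul, one_div, inv_mul_cancel₀ hp0.ne', ENNReal.rpow_one]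
  have hl₀t : l₀ ≠ ∞ := ENNReal.rpow_ne_top_of_nonneg (by positivity)
    (ENNReal.div_lt_top hEt hd0).ne
  have key : ∀ n : ℕ, chainInf p (K ^ p) x y g ε ≤
      (ENNReal.ofReal K * (l₀ + ((n : ℝ≥0∞) + 1)⁻¹) * edist x y) ^ p := by
    intro n
    -- The increment keeps `l` positive when the energy of `g` vanishes, so that division by `l`
    -- bounds the length; it is removed by `n → ∞`.
    set l : ℝ≥0∞ := l₀ + ((n : ℝ≥0∞) + 1)⁻¹ with hl
    have hl0 : l ≠ 0 := by simp [hl]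
    have hlt : l ≠ ∞ := by simp [hl, hl₀t]
    have hle : E ≤ l ^ p * edist x y := by
      calc E = l₀ ^ p * edist x y := by rw [hl₀p, ENNReal.div_mul_cancel hd0 hdt]
        _ ≤ _ := by gcongr; exact le_self_add
    obtain ⟨c, h1, h2, h3, h4⟩ := hE.exists_pointChain_add_const h hCD hp hC hL hxy hg hgx hgy
      hl0 hlt hle hε
    have hlen : c.length ≤ ENNReal.ofReal (K ^ p) * edist x y := by
      have h5 : l * c.length ≤ l * (ENNReal.ofReal K * edist x y) := by
        rw [← c.integral_const]
        refine (c.integral_mono fun z => le_add_self).trans (h4.trans (le_of_eq ?_))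
        ring
      refine ((ENNReal.mul_le_mul_iff_right hl0 hlt).1 h5).trans ?_
      gcongr
      -- As `K ≥ 1`, the one constant `K ^ p` serves for both length and energy.
      exact Real.self_le_rpow_of_one_le hK1 hp
    refine (iInf₂_le c ⟨h1, h2, h3, hlen⟩).trans ?_
    refine ENNReal.rpow_le_rpow ?_ hp0.le
    exact (c.integral_mono fun z => le_self_add).trans h4
  have hlim : Tendsto (fun n : ℕ =>
      (ENNReal.ofReal K * (l₀ + ((n : ℝ≥0∞) + 1)⁻¹) * edist x y) ^ p) atTop
      (𝓝 ((ENNReal.ofReal K * (l₀ + 0) * edist x y) ^ p)) := by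
    refine (ENNReal.continuous_rpow_const.tendsto _).comp ?_
    refine ENNReal.Tendsto.mul_const ?_ (Or.inr hdt)
    refine ENNReal.Tendsto.const_mul ?_ (Or.inr ENNReal.ofReal_ne_top)
    refine tendsto_const_nhds.add ?_
    have := (tendsto_add_atTop_iff_nat 1).2 ENNReal.tendsto_inv_nat_nhds_zero
    simpa using this
  refine (ge_of_tendsto' hlim key).trans (le_of_eq ?_)
  unfold rieszEnergy
  rw [add_zero, ENNReal.mul_rpow_of_nonneg _ _ hp0.le, ENNReal.mul_rpow_of_nonneg _ _ hp0.le,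
    hKp, hl₀p, ← edist_rpow_sub_one_mul hxy, ← hEdef]
  calc _ = ENNReal.ofReal (K ^ p) * edist x y ^ (p - 1) * (E / edist x y * edist x y) := by ring
    _ = _ := by rw [ENNReal.div_mul_cancel hd0 hdt]

end ChainEstimate

/-! ### Rectifiable curves and arc-length parametrization. -/

section Curves

variable {X : Type*} [MetricSpace X] {γ : ℝ → X} {a b : ℝ}

namespace IsRectifiableCurve

lemma locallyBoundedVariationOn (h : IsRectifiableCurve γ a b) :
    LocallyBoundedVariationOn γ (Icc a b) :=
  BoundedVariationOn.locallyBoundedVariationOn h.2.2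

/-- The one-sided jumps of the variation are the jumps of the curve, which vanish by continuity. -/
lemma continuousOn_variationOnFromTo (h : IsRectifiableCurve γ a b) :
    ContinuousOn (variationOnFromTo γ (Icc a b) a) (Icc a b) := by
  intro t ht
  have ha : a ∈ Icc a b := left_mem_Icc.2 h.1.le
  have hl : ContinuousWithinAt (variationOnFromTo γ (Icc a b) a) (Icc a b ∩ Iio t) t := by
    have := variationOnFromTo.tendsto_left ha ht h.locallyBoundedVariationOn
      ((h.2.1 t ht).mono inter_subset_left)
    rwa [dist_self, sub_zero] at this
  have hr : ContinuousWithinAt (variationOnFromTo γ (Icc a b) a) (Icc a b ∩ Ioi t) t := by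
    have := variationOnFromTo.tendsto_right ha ht h.locallyBoundedVariationOn
      ((h.2.1 t ht).mono inter_subset_left)
    rwa [dist_self, add_zero] at this
  refine ((hl.union continuousWithinAt_singleton).union hr).mono fun r hr => ?_
  rcases lt_trichotomy r t with h1 | h1 | h1
  · exact Or.inl (Or.inl ⟨hr, h1⟩)
  · exact Or.inl (Or.inr h1)
  · exact Or.inr ⟨hr, h1⟩

lemma variationOnFromTo_right (h : IsRectifiableCurve γ a b) :
    variationOnFromTo γ (Icc a b) a b = (eVariationOn γ (Icc a b)).toReal := by
  rw [variationOnFromTo.eq_of_le _ _ h.1.le, inter_self]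

lemma image_variationOnFromTo (h : IsRectifiableCurve γ a b) :
    variationOnFromTo γ (Icc a b) a '' Icc a b = Icc 0 (eVariationOn γ (Icc a b)).toReal := by
  have ha : a ∈ Icc a b := left_mem_Icc.2 h.1.le
  have hb : b ∈ Icc a b := right_mem_Icc.2 h.1.le
  have hm := variationOnFromTo.monotoneOn h.locallyBoundedVariationOn ha
  rw [← h.variationOnFromTo_right, ← variationOnFromTo.self γ (Icc a b) a]
  refine Subset.antisymm ?_ (intermediate_value_Icc h.1.le h.continuousOn_variationOnFromTo)
  rintro _ ⟨t, ht, rfl⟩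
  exact ⟨hm ha ht ht.1, hm ht hb ht.2⟩

lemma naturalParameterization_variationOnFromTo (h : IsRectifiableCurve γ a b) {t : ℝ}
    (ht : t ∈ Icc a b) :
    naturalParameterization γ (Icc a b) a (variationOnFromTo γ (Icc a b) a t) = γ t :=
  edist_eq_zero.1 (edist_naturalParameterization_eq_zero h.locallyBoundedVariationOn
    (left_mem_Icc.2 h.1.le) ht)

lemma lipschitzOnWith_naturalParameterization (h : IsRectifiableCurve γ a b) :
    LipschitzOnWith 1 (naturalParameterization γ (Icc a b) a)
      (Icc 0 (eVariationOn γ (Icc a b)).toReal) := by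
  have hs := has_unit_speed_naturalParameterization γ h.locallyBoundedVariationOn
    (left_mem_Icc.2 h.1.le)
  rw [h.image_variationOnFromTo] at hs
  intro s hs' t ht'
  wlog hst : s ≤ t generalizing s t
  · rw [edist_comm, edist_comm s]
    exact this ht' hs' (not_le.1 hst).le
  refine (eVariationOn.edist_le _ (s := Icc 0 (eVariationOn γ (Icc a b)).toReal ∩ Icc s t)
    ⟨hs', left_mem_Icc.2 hst⟩ ⟨ht', right_mem_Icc.2 hst⟩).trans ?_
  rw [hs hs' ht', edist_comm, edist_dist, Real.dist_eq, abs_of_nonneg (by linarith)]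
  simp

end IsRectifiableCurve

/-- As `σ` is `1`-Lipschitz, parameters within `ε` of `t` go into the `ε`-ball of `σ t`, so the
slope at each scale `ε` bounds the difference quotients. -/
lemma enorm_deriv_comp_le_localLip {u : X → ℝ} {K : NNReal} (hu : LipschitzWith K u) {σ : ℝ → X}
    {S : ℝ} (hσ : LipschitzOnWith 1 σ (Icc 0 S)) {t : ℝ} (ht : t ∈ Ioo 0 S) :
    ‖deriv (u ∘ σ) t‖ₑ ≤ localLip u (σ t) := by
  refine le_iInf₂ fun ε hε => ?_
  have hfin : slope ε u (σ t) ≠ ∞ :=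
    ((slope_le_of_lipschitz hu _).trans_lt ENNReal.coe_lt_top).ne
  have hd : ‖deriv (u ∘ σ) t‖ ≤ (slope ε u (σ t)).toReal := by
    refine norm_deriv_le_of_lip' ENNReal.toReal_nonneg ?_
    have h1 : Icc 0 S ∈ 𝓝 t := Icc_mem_nhds ht.1 ht.2
    have h2 : Metric.ball t ε ∈ 𝓝 t := Metric.ball_mem_nhds t hε
    filter_upwards [h1, h2] with r hr1 hr2
    have h3 := hσ hr1 (Ioo_subset_Icc_self ht)
    rw [ENNReal.coe_one, one_mul] at h3
    have h4 : dist (σ r) (σ t) ≤ dist r t := by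
      rwa [edist_dist, edist_dist, ENNReal.ofReal_le_ofReal_iff dist_nonneg] at h3
    have h5 := edist_le_slope_mul u (h4.trans_lt hr2)
    have h6 : edist (u (σ r)) (u (σ t)) ≤ slope ε u (σ t) * edist r t := by
      refine h5.trans ?_
      gcongr
    have h7 := ENNReal.toReal_mono (ENNReal.mul_ne_top hfin (edist_ne_top _ _)) h6
    rw [ENNReal.toReal_mul, ← dist_edist, ← dist_edist, dist_eq_norm, dist_eq_norm] at h7
    exact h7
  rw [← ofReal_norm]
  exact ENNReal.ofReal_le_of_le_toReal hd

/-- The local Lipschitz constant of a Lipschitz function is an upper gradient. -/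
lemma isUpperGradient_localLip [MeasurableSpace X] [BorelSpace X] {u : X → ℝ} {K : NNReal}
    (hu : LipschitzWith K u) : IsUpperGradient u (localLip u) := by
  refine ⟨measurable_localLip hu.continuous, fun γ a b h => ?_⟩
  unfold curveIntegral
  set S := (eVariationOn γ (Icc a b)).toReal with hS
  set σ := naturalParameterization γ (Icc a b) a with hσdef
  have hS0 : 0 ≤ S := ENNReal.toReal_nonneg
  have hσ : LipschitzOnWith 1 σ (Icc 0 S) := h.lipschitzOnWith_naturalParameterization
  have hσ0 : σ 0 = γ a := by
    have := h.naturalParameterization_variationOnFromTo (left_mem_Icc.2 h.1.le)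
    rwa [variationOnFromTo.self] at this
  have hσS : σ S = γ b := by
    have := h.naturalParameterization_variationOnFromTo (right_mem_Icc.2 h.1.le)
    rwa [h.variationOnFromTo_right] at this
  have hlip : LipschitzOnWith (K * 1) (u ∘ σ) (uIcc 0 S) := by
    rw [uIcc_of_le hS0]
    exact hu.comp_lipschitzOnWith hσ
  -- `u ∘ σ` is Lipschitz, hence the integral of its derivative.
  have hftc := hlip.absolutelyContinuousOnInterval.integral_deriv_eq_sub
  rw [intervalIntegral.integral_of_le hS0, integral_Ioc_eq_integral_Ioo] at hftc
  rw [← hσ0, ← hσS, edist_eq_enorm_sub]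
  change ‖(u ∘ σ) S - (u ∘ σ) 0‖ₑ ≤ _
  rw [← hftc]
  calc _ ≤ ∫⁻ t in Ioo 0 S, ‖deriv (u ∘ σ) t‖ₑ := enorm_integral_le_lintegral_enorm _
    _ ≤ ∫⁻ t in Ioo 0 S, localLip u (σ t) :=
      setLIntegral_mono' measurableSet_Ioo fun t ht => enorm_deriv_comp_le_localLip hu hσ ht
    _ ≤ _ := lintegral_mono_set Ioo_subset_Icc_self

lemma UpperGradientEstimate.lipEstimate [MeasurableSpace X] [BorelSpace X] {μ : Measure X}
    {p C L : ℝ} {x y : X} (H : UpperGradientEstimate μ p x y C L) : LipEstimate μ p x y C L :=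
  fun u ⟨_, hu⟩ => H u hu.continuous.measurable _ (isUpperGradient_localLip hu)

variable {ℓ : ℝ}

lemma eVariationOn_le_of_lipschitzOnWith {s t : ℝ} (hst : s ≤ t)
    (hγ : LipschitzOnWith 1 γ (Icc s t)) : eVariationOn γ (Icc s t) ≤ ENNReal.ofReal (t - s) := by
  have h1 := hγ.comp_eVariationOn_le (g := id) (s := Icc s t) (mapsTo_id _)
  rw [ENNReal.coe_one, one_mul] at h1
  refine h1.trans ?_
  have h2 := (monotone_id (α := ℝ)).monotoneOn (Icc s t) |>.eVariationOn_eq (left_mem_Icc.2 hst)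
    (right_mem_Icc.2 hst)
  rw [inter_self] at h2
  exact h2.le

lemma isRectifiableCurve_of_lipschitzOnWith (hℓ : 0 < ℓ) (hγ : LipschitzOnWith 1 γ (Icc 0 ℓ)) :
    IsRectifiableCurve γ 0 ℓ :=
  ⟨hℓ, hγ.continuousOn,
    ((eVariationOn_le_of_lipschitzOnWith hℓ.le hγ).trans_lt ENNReal.ofReal_lt_top).ne⟩

lemma volume_image_le_of_lipschitzOnWith {v : ℝ → ℝ} {s : Set ℝ} (hv : LipschitzOnWith 1 v s) :
    volume (v '' s) ≤ volume s := by
  have := hv.hausdorffMeasure_image_le (d := 1) zero_le_one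
  simpa [hausdorffMeasure_real] using this

/-- The integral along a curve with speed at most one is at most the integral in the parameter. -/
lemma curveIntegral_le_of_lipschitzOnWith (hℓ : 0 < ℓ) (hγ : LipschitzOnWith 1 γ (Icc 0 ℓ))
    (g : X → ℝ≥0∞) : curveIntegral g γ 0 ℓ ≤ ∫⁻ t in Icc 0 ℓ, g (γ t) := by
  have h := isRectifiableCurve_of_lipschitzOnWith hℓ hγ
  set v := variationOnFromTo γ (Icc 0 ℓ) 0 with hv
  have h0 : (0 : ℝ) ∈ Icc 0 ℓ := left_mem_Icc.2 hℓ.le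
  have hvlip : LipschitzOnWith 1 v (Icc 0 ℓ) := by
    intro s hs t ht
    wlog hst : s ≤ t generalizing s t
    · rw [edist_comm, edist_comm s]
      exact this ht hs (not_le.1 hst).le
    have h1 := variationOnFromTo.add h.locallyBoundedVariationOn h0 hs ht
    have h2 := variationOnFromTo.eq_of_le γ (Icc 0 ℓ) hst
    have hsub : Icc 0 ℓ ∩ Icc s t = Icc s t :=
      inter_eq_right.2 (Icc_subset_Icc hs.1 ht.2)
    rw [hsub] at h2
    have h3 := eVariationOn_le_of_lipschitzOnWith hst (hγ.mono (Icc_subset_Icc hs.1 ht.2))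
    have h4 : (eVariationOn γ (Icc s t)).toReal ≤ t - s :=
      ENNReal.toReal_le_of_le_ofReal (by linarith) h3
    have h5 : 0 ≤ (eVariationOn γ (Icc s t)).toReal := ENNReal.toReal_nonneg
    rw [ENNReal.coe_one, one_mul, edist_comm, edist_comm s, edist_dist, edist_dist, Real.dist_eq,
      Real.dist_eq, abs_of_nonneg (by rw [hv]; linarith), abs_of_nonneg (by linarith)]
    exact ENNReal.ofReal_le_ofReal (by rw [hv]; linarith)
  -- The arc-length function `v` is `1`-Lipschitz and maps onto the length interval, so it does not
  -- increase Lebesgue measure; hence Lebesgue measure there is at most the push-forward.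
  have hle : volume.restrict (Icc 0 (eVariationOn γ (Icc 0 ℓ)).toReal) ≤
      Measure.map v (volume.restrict (Icc 0 ℓ)) := by
    refine Measure.le_iff.2 fun A hA => ?_
    rw [Measure.map_apply_of_aemeasurable
      (hvlip.continuousOn.aemeasurable measurableSet_Icc) hA, Measure.restrict_apply hA,
      Measure.restrict_apply' measurableSet_Icc, ← h.image_variationOnFromTo]
    refine le_trans (measure_mono ?_)
      (volume_image_le_of_lipschitzOnWith (hvlip.mono (inter_subset_right (s := v ⁻¹' A))))
    rintro _ ⟨hr, t, ht, rfl⟩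
    exact ⟨t, ⟨hr, ht⟩, rfl⟩
  unfold curveIntegral
  calc _ ≤ ∫⁻ r, g (naturalParameterization γ (Icc 0 ℓ) 0 r)
        ∂(Measure.map v (volume.restrict (Icc 0 ℓ))) := lintegral_mono' hle le_rfl
    _ ≤ ∫⁻ t in Icc 0 ℓ, g (naturalParameterization γ (Icc 0 ℓ) 0 (v t)) := lintegral_map_le _ _
    _ = _ := by
      refine setLIntegral_congr_fun measurableSet_Icc fun t ht => ?_
      rw [hv, h.naturalParameterization_variationOnFromTo ht]

end Curves

/-! ### Complete doubling spaces are proper. -/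

section Proper

variable {X : Type*} [MetricSpace X] [MeasurableSpace X] [BorelSpace X]
  {μ : Measure X} {CD : ℝ}

/-- Otherwise an infinite `ε`-separated sequence would give disjoint balls of mass bounded below, by
doubling, inside a ball of finite mass. -/
lemma IsDoublingMetricMeasureSpace.totallyBounded_closedBall
    (h : IsDoublingMetricMeasureSpace μ CD) (x : X) (R : ℝ) :
    TotallyBounded (Metric.closedBall x R) := by
  rcases lt_or_ge R 0 with hR | hR
  · rw [Metric.closedBall_eq_empty.2 hR]; exact totallyBounded_empty
  rw [Metric.totallyBounded_iff]
  intro ε hε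
  by_contra hcon
  push Not at hcon
  obtain ⟨q, hq1, hq2⟩ := exists_seq_of_forall_finset_exists (fun z => z ∈ Metric.closedBall x R)
    (fun a b => ε ≤ dist a b) (fun s _ => by
      obtain ⟨z, hz, hz'⟩ := not_subset.1 (hcon s s.finite_toSet)
      refine ⟨z, hz, fun a ha => ?_⟩
      by_contra hlt
      refine hz' (mem_iUnion₂.2 ⟨a, ha, ?_⟩)
      rw [Metric.mem_ball, dist_comm]
      exact not_le.1 hlt)
  have hdisj : Pairwise (Function.onFun Disjoint fun n => Metric.ball (q n) (ε / 2)) := by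
    intro m n hmn
    refine Metric.ball_disjoint_ball ?_
    rcases lt_or_gt_of_ne hmn with hlt | hlt
    · linarith [hq2 m n hlt]
    · rw [dist_comm]; linarith [hq2 n m hlt]
  have hsub : ⋃ n, Metric.ball (q n) (ε / 2) ⊆ Metric.ball x (R + ε) :=
    iUnion_subset fun n => Metric.ball_subset_ball' (by
      have := Metric.mem_closedBall.1 (hq1 n)
      linarith)
  obtain ⟨k, hk⟩ := pow_unbounded_of_one_lt ((R + ε + R) / (ε / 2)) (one_lt_two (α := ℝ))
  rw [div_lt_iff₀ (by positivity)] at hk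
  set c := μ (Metric.ball x (R + ε)) / ENNReal.ofReal CD ^ k with hc
  have hle : ∀ n, c ≤ μ (Metric.ball (q n) (ε / 2)) := by
    intro n
    refine ENNReal.div_le_of_le_mul' (h.measure_ball_le (by positivity) k ?_)
    have := Metric.mem_closedBall.1 (hq1 n)
    linarith
  have hc0 : c ≠ 0 := by
    rw [hc, ne_eq, ENNReal.div_eq_zero_iff, not_or]
    exact ⟨(h.measure_ball_pos x (by positivity)).ne', ENNReal.pow_ne_top ENNReal.ofReal_ne_top⟩
  have htop : ∞ ≤ μ (Metric.ball x (R + ε)) := by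
    calc ∞ = ∑' _ : ℕ, c := (ENNReal.tsum_const_eq_top_of_ne_zero hc0).symm
      _ ≤ ∑' n, μ (Metric.ball (q n) (ε / 2)) := ENNReal.tsum_le_tsum hle
      _ = μ (⋃ n, Metric.ball (q n) (ε / 2)) :=
        (measure_iUnion hdisj fun n => Metric.isOpen_ball.measurableSet).symm
      _ ≤ _ := measure_mono hsub
  exact (h.measure_ball_lt_top x _).not_ge htop

lemma IsDoublingMetricMeasureSpace.properSpace [CompleteSpace X]
    (h : IsDoublingMetricMeasureSpace μ CD) : ProperSpace X :=
  ⟨fun x R => (h.totallyBounded_closedBall x R).isCompact_of_isClosed Metric.isClosed_closedBall⟩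

end Proper

/-! ### Limits of chains of vanishing mesh. -/

section Limit

variable {X : Type*} [MetricSpace X] {x y z : X}

/-- A chain as a (discontinuous) curve parametrized by length. -/
lemma ChainCost.exists_curve {ε : ℝ} (hε : 0 ≤ ε) {G : X → ℝ≥0∞} {t l : ℝ≥0∞}
    (h : ChainCost ε G x z t) :
    ∃ (ℓ : ℝ) (γ : ℝ → X), 0 ≤ ℓ ∧ γ 0 = x ∧ (∀ s, 0 ≤ s → s ≤ ℓ → dist (γ s) z ≤ ℓ - s) ∧
      (∀ s, ℓ < s → γ s = z) ∧ (∀ s r, 0 ≤ s → s ≤ r → dist (γ s) (γ r) ≤ r - s + ε) ∧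
      ∀ (F : X → ℝ≥0∞) (K : ℝ≥0∞), (∀ a b, F a ≤ F b + K * edist a b) → (∀ a, F a + l ≤ G a) →
        (∫⁻ s in Icc 0 ℓ, F (γ s)) + l * ENNReal.ofReal ℓ ≤
          t + K * ENNReal.ofReal ε * ENNReal.ofReal ℓ := by
  induction h with
  | refl =>
    refine ⟨0, fun _ => x, le_rfl, rfl, fun s h1 h2 => ?_, fun _ _ => rfl, fun s r _ h2 => ?_,
      fun F K _ _ => by simp⟩
    · rw [dist_self]; linarith
    · rw [dist_self]; linarith
  | @step z w t _ hd ih =>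
    obtain ⟨ℓ, γ, hℓ, hγ0, hA, hend, hB, hint⟩ := ih
    have hdn : 0 ≤ dist z w := dist_nonneg
    -- The curve jumps to `w` just after time `ℓ` and waits there for time `d(z,w)`.
    set γ' : ℝ → X := fun s => if s ≤ ℓ then γ s else w with hγ'
    have h1 : ∀ s, s ≤ ℓ → γ' s = γ s := fun s hs => if_pos hs
    have h2 : ∀ s, ℓ < s → γ' s = w := fun s hs => if_neg hs.not_ge
    refine ⟨ℓ + dist z w, γ', by linarith, by rw [h1 0 hℓ, hγ0], fun s hs0 hs => ?_,
      fun s hs => h2 s (by linarith), fun s r hs hsr => ?_, fun F K hF hFG => ?_⟩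
    · rcases le_or_gt s ℓ with hsl | hsl
      · rw [h1 s hsl]
        have := dist_triangle (γ s) z w
        linarith [hA s hs0 hsl]
      · rw [h2 s hsl, dist_self]; linarith
    · rcases le_or_gt r ℓ with hrl | hrl
      · rw [h1 s (hsr.trans hrl), h1 r hrl]; exact hB s r hs hsr
      · rw [h2 r hrl]
        rcases le_or_gt s ℓ with hsl | hsl
        · rw [h1 s hsl]
          have := dist_triangle (γ s) z w
          linarith [hA s hs hsl]
        · rw [h2 s hsl, dist_self]; linarith
    · have hsplit : Icc 0 (ℓ + dist z w) ⊆ Icc 0 ℓ ∪ Ioc ℓ (ℓ + dist z w) := by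
        intro s hs
        rcases le_or_gt s ℓ with hsl | hsl
        · exact Or.inl ⟨hs.1, hsl⟩
        · exact Or.inr ⟨hsl, hs.2⟩
      have hI1 : ∫⁻ s in Icc 0 ℓ, F (γ' s) = ∫⁻ s in Icc 0 ℓ, F (γ s) :=
        setLIntegral_congr_fun measurableSet_Icc fun s hs => by rw [h1 s hs.2]
      have hI2 : ∫⁻ s in Ioc ℓ (ℓ + dist z w), F (γ' s) = F w * edist z w := by
        rw [setLIntegral_congr_fun (g := fun _ => F w) measurableSet_Ioc
          fun s hs => by rw [h2 s hs.1], setLIntegral_const, Real.volume_Ioc, edist_dist]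
        congr 2; ring
      -- The curve sees the right endpoint value and the chain the mean of both; the Lipschitz bound
      -- on `F` limits the difference to `K ε` per unit length.
      have hFw : F w + l ≤ (G z + G w) / 2 + K * ENNReal.ofReal ε := by
        have h3 : F w ≤ F z + K * ENNReal.ofReal ε := by
          refine (hF w z).trans ?_
          gcongr
          rw [edist_comm, edist_dist]
          exact ENNReal.ofReal_le_ofReal hd
        calc F w + l = ((F w + l) + (F w + l)) / 2 := by
              rw [ENNReal.add_div, ENNReal.add_halves]
          _ ≤ ((F z + K * ENNReal.ofReal ε + l) + (F w + l)) / 2 := by gcongr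
          _ = ((F z + l) + (F w + l)) / 2 + K * ENNReal.ofReal ε / 2 := by
              rw [← ENNReal.add_div]; congr 1; ring
          _ ≤ _ := by
            gcongr
            · exact hFG z
            · exact hFG w
            · exact ENNReal.half_le_self
      calc _ ≤ ((∫⁻ s in Icc 0 ℓ, F (γ s)) + F w * edist z w) +
            l * (ENNReal.ofReal ℓ + edist z w) := by
            rw [ENNReal.ofReal_add hℓ hdn, ← edist_dist]
            gcongr
            refine (lintegral_mono_set hsplit).trans ((lintegral_union_le _ _ _).trans ?_)
            rw [hI1, hI2]
        _ = ((∫⁻ s in Icc 0 ℓ, F (γ s)) + l * ENNReal.ofReal ℓ) + (F w + l) * edist z w := by ring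
        _ ≤ (t + K * ENNReal.ofReal ε * ENNReal.ofReal ℓ) +
            ((G z + G w) / 2 + K * ENNReal.ofReal ε) * edist z w :=
            add_le_add (hint F K hF hFG) (by gcongr)
        _ = _ := by
            rw [ENNReal.ofReal_add hℓ hdn, ← edist_dist]; ring

/-- Pointwise convergence on a finite net is uniform because the curves are equicontinuous up to the
vanishing error `e n`. -/
lemma eventually_forall_dist_le {U : Filter ℕ} {Γ : ℕ → ℝ → X} {γ : ℝ → X} {e : ℕ → ℝ}
    (he : Tendsto e U (𝓝 0)) (hΓ : ∀ n s r, dist (Γ n s) (Γ n r) ≤ dist s r + e n)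
    (hγ : LipschitzWith 1 γ) (hlim : ∀ s, Tendsto (fun n => Γ n s) U (𝓝 (γ s))) (ℓ : ℝ) {η : ℝ}
    (hη : 0 < η) : ∀ᶠ n in U, ∀ s ∈ Icc 0 ℓ, dist (Γ n s) (γ s) ≤ η := by
  obtain ⟨T, _, hT⟩ := isCompact_Icc.elim_nhds_subcover (s := Icc 0 ℓ)
    (fun s => Metric.ball s (η / 4)) fun s _ => Metric.ball_mem_nhds s (by positivity)
  have h1 : ∀ᶠ n in U, ∀ r ∈ T, dist (Γ n r) (γ r) < η / 4 :=
    (eventually_all_finset T).2 fun r _ =>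
      (hlim r).eventually (Metric.ball_mem_nhds _ (by positivity))
  have h2 : ∀ᶠ n in U, e n < η / 4 := he.eventually (gt_mem_nhds (by positivity))
  filter_upwards [h1, h2] with n hn1 hn2 s hs
  obtain ⟨r, hr, hsr⟩ := mem_iUnion₂.1 (hT hs)
  have h3 : dist s r < η / 4 := hsr
  have h4 := hΓ n s r
  have h5 : dist (γ r) (γ s) ≤ dist s r := by
    have := hγ.dist_le_mul r s
    rwa [NNReal.coe_one, one_mul, dist_comm r s] at this
  have h6 := dist_triangle4 (Γ n s) (Γ n r) (γ r) (γ s)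
  linarith [hn1 r hr]

/-- Compactness: chains of smaller and smaller mesh converge to a curve. -/
lemma exists_curve_of_chainCost [ProperSpace X] (hxy : x ≠ y) {F : ℕ → X → ℝ≥0∞}
    (hmono : Monotone F) (hlip : ∀ m a b, F m a ≤ F m b + m * edist a b) (hfin : ∀ m, F m y ≠ ∞)
    {l B : ℝ≥0∞} (hl0 : l ≠ 0) (hlt : l ≠ ∞) (hB : B ≠ ∞)
    (hchain : ∀ n : ℕ, ∃ t ≤ B, ChainCost (1 / ((n : ℝ) + 1)) (fun a => F n a + l) x y t) :
    ∃ (ℓ : ℝ) (γ : ℝ → X), 0 < ℓ ∧ LipschitzWith 1 γ ∧ γ 0 = x ∧ γ ℓ = y ∧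
      ∀ m, ∫⁻ s in Icc 0 ℓ, F m (γ s) ≤ B := by
  set e : ℕ → ℝ := fun n => 1 / ((n : ℝ) + 1) with he
  have he0 : ∀ n, 0 ≤ e n := fun n => by rw [he]; positivity
  choose t ht hc using hchain
  choose len c hlen hc0 hcA hcend hcB hcint using fun n => (hc n).exists_curve (l := l) (he0 n)
  set Λ := (B / l).toReal with hΛ
  have hlenΛ : ∀ n, len n ≤ Λ := by
    intro n
    -- Testing with `F = 0` leaves only the term in `l`, which bounds the length by `B / l`.
    have h1 := hcint n (fun _ => 0) 0 (by simp) (fun a => by simp)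
    simp only [lintegral_const, zero_mul, zero_add, add_zero] at h1
    refine (ENNReal.ofReal_le_iff_le_toReal (ENNReal.div_lt_top hB hl0).ne).1 ?_
    rw [ENNReal.le_div_iff_mul_le (Or.inl hl0) (Or.inl hlt), mul_comm]
    exact h1.trans (ht n)
  have hΛ0 : 0 ≤ Λ := ENNReal.toReal_nonneg
  -- Limits along an ultrafilter replace the extraction of subsequences.
  set U := hyperfilter ℕ with hU
  have hUat : (U : Filter ℕ) ≤ atTop := by
    rw [← Nat.cofinite_eq_atTop]; exact hyperfilter_le_cofinite
  set Γ : ℕ → ℝ → X := fun n s => c n (max s 0) with hΓ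
  have hΓd : ∀ n s r, dist (Γ n s) (Γ n r) ≤ dist s r + e n := by
    intro n s r
    wlog hsr : s ≤ r generalizing s r
    · rw [dist_comm, dist_comm s]; exact this r s (not_le.1 hsr).le
    refine (hcB n _ _ (le_max_right s 0) (max_le_max_right 0 hsr)).trans ?_
    rw [dist_comm, Real.dist_eq, abs_of_nonneg (by linarith)]
    have : max r 0 - max s 0 ≤ r - s := by
      rcases max_cases r 0 with h | h <;> rcases max_cases s 0 with h' | h' <;> linarith
    linarith
  have hΓy : ∀ n s, Γ n s ∈ Metric.closedBall y Λ := by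
    intro n s
    rw [Metric.mem_closedBall, hΓ]
    dsimp only
    rcases le_or_gt (max s 0) (len n) with h | h
    · linarith [hcA n _ (le_max_right s 0) h, hlenΛ n, le_max_right s 0]
    · rw [hcend n _ h, dist_self]; exact hΛ0
  have hlimΓ : ∀ s, ∃ z, Tendsto (fun n => Γ n s) U (𝓝 z) := fun s => by
    obtain ⟨z, _, hz⟩ := (isCompact_closedBall y Λ).ultrafilter_le_nhds
      (U.map fun n => Γ n s) (by
        rw [Ultrafilter.coe_map, le_principal_iff]
        exact Eventually.of_forall (f := (U : Filter ℕ)) fun n => hΓy n s)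
    exact ⟨z, hz⟩
  choose γ hγ using hlimΓ
  obtain ⟨ℓ, hℓmem, hℓ⟩ : ∃ ℓ ∈ Icc 0 Λ, Tendsto len U (𝓝 ℓ) := by
    obtain ⟨z, hz', hz⟩ := (isCompact_Icc (a := (0 : ℝ)) (b := Λ)).ultrafilter_le_nhds
      (U.map len) (by
        rw [Ultrafilter.coe_map, le_principal_iff]
        exact Eventually.of_forall (f := (U : Filter ℕ)) fun n => ⟨hlen n, hlenΛ n⟩)
    exact ⟨z, hz', hz⟩
  have heU : Tendsto e U (𝓝 0) := tendsto_one_div_add_atTop_nhds_zero_nat.mono_left hUat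
  have hγlip : LipschitzWith 1 γ := by
    refine LipschitzWith.of_dist_le_mul fun s r => ?_
    rw [NNReal.coe_one, one_mul]
    have h1 : Tendsto (fun n => dist s r + e n) U (𝓝 (dist s r + 0)) := tendsto_const_nhds.add heU
    rw [add_zero] at h1
    exact le_of_tendsto_of_tendsto' ((hγ s).dist (hγ r)) h1 fun n => hΓd n s r
  have hγ0 : γ 0 = x := by
    refine tendsto_nhds_unique (hγ 0) ?_
    have : ∀ n, Γ n 0 = x := fun n => by rw [hΓ]; simpa using hc0 n
    simp only [this]
    exact tendsto_const_nhds
  have hΓlen : ∀ n, Γ n (len n) = y := fun n => by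
    have := hcA n (len n) (hlen n) le_rfl
    rw [sub_self] at this
    rw [hΓ]; dsimp only
    rw [max_eq_left (hlen n)]
    exact dist_le_zero.1 this
  have hγℓ : γ ℓ = y := by
    have h1 : Tendsto (fun n => dist ℓ (len n) + e n) U (𝓝 (dist ℓ ℓ + 0)) :=
      (tendsto_const_nhds.dist hℓ).add heU
    rw [dist_self, add_zero] at h1
    have h2 : dist (γ ℓ) y ≤ 0 :=
      le_of_tendsto_of_tendsto' ((hγ ℓ).dist tendsto_const_nhds) h1 fun n => by
        have := hΓd n ℓ (len n)
        rwa [hΓlen n] at this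
    exact dist_le_zero.1 h2
  have hℓ0 : 0 < ℓ := by
    refine lt_of_le_of_ne hℓmem.1 fun h => hxy ?_
    rw [← hγ0, ← hγℓ, ← h]
  refine ⟨ℓ, γ, hℓ0, hγlip, hγ0, hγℓ, fun m => ?_⟩
  have key : ∀ k : ℕ, ∫⁻ s in Icc 0 ℓ, F m (γ s) ≤
      B + (m * ENNReal.ofReal Λ + m * ENNReal.ofReal ℓ + F m y) * ENNReal.ofReal (e k) := by
    intro k
    have hk : 0 < e k := by rw [he]; positivity
    have h1 := eventually_forall_dist_le heU hΓd hγlip hγ ℓ hk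
    have h2 : ∀ᶠ n in (U : Filter ℕ), e n < e k := heU.eventually (gt_mem_nhds hk)
    have h3 : ∀ᶠ n in (U : Filter ℕ), ℓ - e k < len n :=
      hℓ.eventually (lt_mem_nhds (by linarith))
    have h4 : ∀ᶠ n in (U : Filter ℕ), m ≤ n := hUat (eventually_ge_atTop m)
    obtain ⟨n, hn1, hn2, hn3, hn4⟩ := (h1.and (h2.and (h3.and h4))).exists
    have hn := hcint n (F m) m (hlip m) (fun a => by gcongr; exact hmono hn4 a)
    have hsplit : Icc 0 ℓ ⊆ Icc 0 (len n) ∪ Ioc (len n) ℓ := by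
      intro s hs
      rcases le_or_gt s (len n) with hsl | hsl
      · exact Or.inl ⟨hs.1, hsl⟩
      · exact Or.inr ⟨hsl, hs.2⟩
    have hI1 : ∫⁻ s in Icc 0 (len n), F m (Γ n s) = ∫⁻ s in Icc 0 (len n), F m (c n s) :=
      setLIntegral_congr_fun measurableSet_Icc fun s hs => by
        rw [hΓ]; dsimp only; rw [max_eq_left hs.1]
    -- If the `n`-th curve is shorter than `ℓ` it rests at `y` for the remaining time, which tends
    -- to `0`; this is where `F m y` must be finite.
    have hI2 : ∫⁻ s in Ioc (len n) ℓ, F m (Γ n s) = F m y * ENNReal.ofReal (ℓ - len n) := by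
      rw [setLIntegral_congr_fun (g := fun _ => F m y) measurableSet_Ioc fun s hs => by
          rw [hΓ]; dsimp only; rw [max_eq_left ((hlen n).trans hs.1.le), hcend n s hs.1],
        setLIntegral_const, Real.volume_Ioc]
    calc ∫⁻ s in Icc 0 ℓ, F m (γ s)
        ≤ ∫⁻ s in Icc 0 ℓ, (F m (Γ n s) + m * ENNReal.ofReal (e k)) := by
          refine setLIntegral_mono' measurableSet_Icc fun s hs => (hlip m _ (Γ n s)).trans ?_
          gcongr
          rw [edist_comm, edist_dist]
          exact ENNReal.ofReal_le_ofReal (hn1 s hs)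
      _ = (∫⁻ s in Icc 0 ℓ, F m (Γ n s)) + m * ENNReal.ofReal (e k) * ENNReal.ofReal ℓ := by
          rw [lintegral_add_right _ measurable_const, setLIntegral_const, Real.volume_Icc, sub_zero]
      _ ≤ ((∫⁻ s in Icc 0 (len n), F m (c n s)) + F m y * ENNReal.ofReal (ℓ - len n)) +
          m * ENNReal.ofReal (e k) * ENNReal.ofReal ℓ := by
          gcongr
          refine (lintegral_mono_set hsplit).trans ((lintegral_union_le _ _ _).trans ?_)
          rw [hI1, hI2]
      _ ≤ ((B + m * ENNReal.ofReal (e k) * ENNReal.ofReal Λ) + F m y * ENNReal.ofReal (e k)) +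
          m * ENNReal.ofReal (e k) * ENNReal.ofReal ℓ := by
          gcongr
          · refine (le_self_add.trans hn).trans ?_
            gcongr
            · exact ht n
            · exact hlenΛ n
          · linarith
      _ = _ := by ring
  have hlim : Tendsto (fun k : ℕ => B + (m * ENNReal.ofReal Λ + m * ENNReal.ofReal ℓ + F m y) *
      ENNReal.ofReal (e k)) atTop
      (𝓝 (B + (m * ENNReal.ofReal Λ + m * ENNReal.ofReal ℓ + F m y) * ENNReal.ofReal 0)) := by
    refine tendsto_const_nhds.add (ENNReal.Tendsto.const_mul ?_ (Or.inr ?_))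
    · exact (ENNReal.continuous_ofReal.tendsto 0).comp tendsto_one_div_add_atTop_nhds_zero_nat
    · refine ENNReal.add_ne_top.2 ⟨ENNReal.add_ne_top.2 ⟨?_, ?_⟩, hfin m⟩ <;>
      exact ENNReal.mul_ne_top (by simp) ENNReal.ofReal_ne_top
  rw [ENNReal.ofReal_zero, mul_zero, add_zero] at hlim
  exact ge_of_tendsto' hlim key

end Limit

/-! ### Lipschitz approximation from below. -/

section Approximation

variable {X : Type*} [MetricSpace X]

/-- The `m`-Lipschitz lower approximation of `f`, truncated at height `m`. -/
noncomputable def lipApprox (f : X → ℝ≥0∞) (m : ℕ) (z : X) : ℝ≥0∞ :=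
  ⨅ w, (min (f w) m + m * edist z w)

variable (f : X → ℝ≥0∞)

lemma lipApprox_le_min (m : ℕ) (z : X) : lipApprox f m z ≤ min (f z) m :=
  (iInf_le _ z).trans (by simp)

lemma lipApprox_le (m : ℕ) (z : X) : lipApprox f m z ≤ f z :=
  (lipApprox_le_min f m z).trans (min_le_left _ _)

lemma lipApprox_mono : Monotone (lipApprox f) := by
  intro m n hmn z
  unfold lipApprox
  have : (m : ℝ≥0∞) ≤ n := by exact_mod_cast hmn
  gcongr

lemma lipApprox_le_add (m : ℕ) (a b : X) :
    lipApprox f m a ≤ lipApprox f m b + m * edist a b := by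
  unfold lipApprox
  rw [ENNReal.iInf_add]
  refine iInf_mono fun w => ?_
  calc _ ≤ min (f w) m + m * (edist a b + edist b w) := by
        gcongr
        exact edist_triangle a b w
    _ = _ := by ring

lemma measurable_lipApprox [MeasurableSpace X] [BorelSpace X] (m : ℕ) :
    Measurable (lipApprox f m) := by
  refine UpperSemicontinuous.measurable (upperSemicontinuous_iInf fun w => ?_)
  refine Continuous.upperSemicontinuous (continuous_const.add ?_)
  exact (ENNReal.continuous_const_mul (by simp)).comp (continuous_id.edist continuous_const)

/-- Near `z` lower semicontinuity keeps `f` above `c'`; at distance at least `δ` the penalty `m δ`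
already exceeds it once `m` is large. -/
lemma iSup_lipApprox {f : X → ℝ≥0∞} (hf : LowerSemicontinuous f) (z : X) :
    ⨆ m, lipApprox f m z = f z := by
  refine le_antisymm (iSup_le fun m => lipApprox_le f m z) (le_of_forall_lt fun c hc => ?_)
  obtain ⟨c', hcc', hc'⟩ := exists_between hc
  refine hcc'.trans_le ?_
  obtain ⟨δ, hδ, hball⟩ := EMetric.mem_nhds_iff.1 (hf z c' hc')
  have hct : c' ≠ ∞ := hc'.ne_top
  obtain ⟨m, hm⟩ := ENNReal.exists_nat_gt (r := max c' (c' / δ))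
    (max_lt (lt_top_iff_ne_top.2 hct) (ENNReal.div_lt_top hct hδ.ne')).ne
  rw [max_lt_iff] at hm
  refine le_iSup_of_le m (le_iInf fun w => ?_)
  rcases lt_or_ge (edist z w) δ with hw | hw
  · refine le_trans (le_min ?_ hm.1.le) le_self_add
    have : w ∈ Metric.eball z δ := by rwa [Metric.mem_eball, edist_comm]
    exact (hball this).le
  · refine le_trans ?_ le_add_self
    rcases eq_or_ne δ ∞ with rfl | hδt
    · exact absurd (top_le_iff.1 hw) (edist_ne_top _ _)
    have h1 := (ENNReal.div_le_iff hδ.ne' hδt).1 hm.2.le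
    refine h1.trans ?_
    gcongr

end Approximation

/-! ### Upper gradients along curves in complete spaces. -/

section CurveEstimate

variable {X : Type*} [MetricSpace X] [MeasurableSpace X] [BorelSpace X]
  {μ : Measure X} {CD : ℝ} {x y : X}

/-- The constant in the bound of the integrals along curves. -/
noncomputable def curveConst (p CD C L : ℝ) : ℝ :=
  C * (2 ^ (p - 1) * (1 + 8 * CD * L)) + 1

lemma LipEstimate.exists_curve_le [ProperSpace X]
    (h : IsDoublingMetricMeasureSpace μ CD) (hCD : 1 ≤ CD) {p C L : ℝ} (hp : 1 ≤ p) (hC : 0 < C)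
    (hL : 1 ≤ L) (hxy : x ≠ y) (hE : LipEstimate μ p x y C L) {f : X → ℝ≥0∞}
    (hf : LowerSemicontinuous f) {l : ℝ≥0∞} (hl0 : l ≠ 0) (hlt : l ≠ ∞)
    (hl : ∫⁻ z, f z ^ p ∂(rieszMeasure μ L x y) ≤ l ^ p * edist x y) :
    ∃ (ℓ : ℝ) (γ : ℝ → X), 0 < ℓ ∧ LipschitzWith 1 γ ∧ γ 0 = x ∧ γ ℓ = y ∧
      ∫⁻ s in Icc 0 ℓ, f (γ s) ≤
        ENNReal.ofReal (curveConst p CD C L ^ (1 / p)) * l * edist x y := by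
  have hp0 : 0 < p := zero_lt_one.trans_le hp
  have hd0 : edist x y ≠ 0 := by simpa [edist_eq_zero] using hxy
  have hdt : edist x y ≠ ∞ := edist_ne_top x y
  set K := curveConst p CD C L with hK
  have hK0 : 0 < K := by rw [hK]; unfold curveConst; positivity
  have hI := lintegral_add_const_rpow_le h hp hL hxy hf.measurable hl
  have hlp0 : l ^ p ≠ 0 := (ENNReal.rpow_pos (pos_iff_ne_zero.2 hl0) hlt).ne'
  have hlpt : l ^ p ≠ ∞ := ENNReal.rpow_ne_top_of_nonneg hp0.le hlt
  set B : ℝ≥0∞ := ENNReal.ofReal (K ^ (1 / p)) * l * edist x y with hB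
  have hBp : B ^ p = ENNReal.ofReal K * (l ^ p * edist x y ^ p) := by
    rw [hB, ENNReal.mul_rpow_of_nonneg _ _ hp0.le, ENNReal.mul_rpow_of_nonneg _ _ hp0.le,
      ENNReal.ofReal_rpow_of_nonneg (by positivity) hp0.le, ← Real.rpow_mul hK0.le, one_div,
      inv_mul_cancel₀ hp0.ne', Real.rpow_one, mul_assoc]
  have hBt : B ≠ ∞ := ENNReal.mul_ne_top (ENNReal.mul_ne_top ENNReal.ofReal_ne_top hlt) hdt
  have hen : rieszEnergy μ p C L x y (fun z => f z + l) < B ^ p := by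
    unfold rieszEnergy
    calc _ ≤ ENNReal.ofReal C * edist x y ^ (p - 1) *
          (2 ^ (p - 1) * (1 + ENNReal.ofReal (8 * CD * L)) * l ^ p * edist x y) := by gcongr
      _ = ENNReal.ofReal C * (2 ^ (p - 1) * (1 + ENNReal.ofReal (8 * CD * L))) *
          (l ^ p * (edist x y ^ (p - 1) * edist x y)) := by ring
      _ = ENNReal.ofReal (K - 1) * (l ^ p * edist x y ^ p) := by
        have hq : 0 ≤ 8 * CD * L := by positivity
        rw [edist_rpow_sub_one_mul hxy, hK, curveConst, add_sub_cancel_right]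
        generalize 8 * CD * L = q at hq ⊢
        rw [ENNReal.ofReal_mul (by positivity), ENNReal.ofReal_mul (by positivity),
          ENNReal.ofReal_add (by positivity) (by positivity),
          ← ENNReal.ofReal_rpow_of_pos (by positivity), ENNReal.ofReal_ofNat, ENNReal.ofReal_one]
      _ < ENNReal.ofReal K * (l ^ p * edist x y ^ p) := by
        refine ENNReal.mul_lt_mul_left ?_ ?_ ?_
        · exact mul_ne_zero hlp0 (ENNReal.rpow_pos (pos_iff_ne_zero.2 hd0) hdt).ne'
        · exact ENNReal.mul_ne_top hlpt (edist_rpow_ne_top x y hp0.le)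
        · exact (ENNReal.ofReal_lt_ofReal_iff hK0).2 (by linarith)
      _ = _ := hBp.symm
  -- Half of `l` is put into the cost and bounds the length; the other half absorbs the oscillation
  -- of `lipApprox f n` near each point, so that `f + l` bounds the cost locally.
  have hl2 : l / 2 ≠ 0 := by simpa using hl0
  have hl2t : l / 2 ≠ ∞ := (ENNReal.div_lt_top hlt (by simp)).ne
  obtain ⟨ℓ, γ, h1, h2, h3, h4, h5⟩ := exists_curve_of_chainCost (F := lipApprox f) (l := l / 2)
    (B := B) hxy (lipApprox_mono f) (fun m => lipApprox_le_add f m)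
    (fun m => (((lipApprox_le_min f m y).trans (min_le_right _ _)).trans_lt
      (ENNReal.natCast_lt_top m)).ne) hl2 hl2t hBt (fun n => by
      have hM : ∀ z, lipApprox f n z + l / 2 ≤ ((n + l / 2).toNNReal : NNReal) := by
        intro z
        rw [ENNReal.coe_toNNReal (ENNReal.add_ne_top.2 ⟨by simp, hl2t⟩)]
        gcongr
        exact (lipApprox_le_min f n z).trans (min_le_right _ _)
      have hH : ∀ z, ∃ δ > 0, ∀ w ∈ Metric.ball z δ, lipApprox f n w + l / 2 ≤ f z + l := by
        intro z
        have hpos : 0 < (l / 2).toReal / (n + 1) :=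
          div_pos (ENNReal.toReal_pos hl2 hl2t) (by positivity)
        refine ⟨_, hpos, fun w hw => ?_⟩
        have h6 : n * edist w z ≤ l / 2 := by
          rw [Metric.mem_ball, lt_div_iff₀ (by positivity)] at hw
          rw [edist_dist, ← ENNReal.ofReal_toReal hl2t, ← ENNReal.ofReal_natCast,
            ← ENNReal.ofReal_mul (by positivity)]
          refine ENNReal.ofReal_le_ofReal ?_
          nlinarith [dist_nonneg (x := w) (y := z)]
        calc _ ≤ (lipApprox f n z + n * edist w z) + l / 2 := by
              gcongr; exact lipApprox_le_add f n w z
          _ ≤ (f z + l / 2) + l / 2 := by gcongr; exact lipApprox_le f n z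
          _ = _ := by rw [add_assoc, ENNReal.add_halves]
      have h6 := hE.chainCostInf_rpow_le hp0 (by positivity : (0 : ℝ) < 1 / ((n : ℝ) + 1)) hM hH
      obtain ⟨t, ht, ht'⟩ :=
        exists_chainCost_lt ((ENNReal.rpow_lt_rpow_iff hp0).1 (h6.trans_lt hen))
      exact ⟨t, ht.le, ht'⟩)
  refine ⟨ℓ, γ, h1, h2, h3, h4, ?_⟩
  calc ∫⁻ s in Icc 0 ℓ, f (γ s) = ∫⁻ s in Icc 0 ℓ, ⨆ m, lipApprox f m (γ s) := by
        simp_rw [iSup_lipApprox hf]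
    _ = ⨆ m, ∫⁻ s in Icc 0 ℓ, lipApprox f m (γ s) :=
        lintegral_iSup (fun m => (measurable_lipApprox f m).comp h2.continuous.measurable)
          fun m n hmn s => lipApprox_mono f hmn (γ s)
    _ ≤ B := iSup_le h5

/-- In a complete space, the pointwise estimate for Lipschitz functions implies the one for upper
gradients. -/
lemma LipEstimate.upperGradientEstimate [CompleteSpace X]
    (h : IsDoublingMetricMeasureSpace μ CD) (hCD : 1 ≤ CD) {p C L : ℝ} (hp : 1 ≤ p) (hC : 0 < C)
    (hL : 1 ≤ L) (hE : LipEstimate μ p x y C L) :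
    UpperGradientEstimate μ p x y (curveConst p CD C L) L := by
  intro u _ g hg
  have hp0 : 0 < p := zero_lt_one.trans_le hp
  rcases eq_or_ne x y with rfl | hxy
  · rw [edist_self, ENNReal.zero_rpow_of_pos hp0]; exact zero_le
  have := h.properSpace
  have := isFiniteMeasure_rieszMeasure h hL hxy
  have hd0 : edist x y ≠ 0 := by simpa [edist_eq_zero] using hxy
  have hdt : edist x y ≠ ∞ := edist_ne_top x y
  set K := curveConst p CD C L with hK
  have hK0 : 0 < K := by rw [hK]; unfold curveConst; positivity
  set E := ∫⁻ z, g z ^ p ∂(rieszMeasure μ L x y) with hEdef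
  rcases eq_or_ne E ∞ with hEt | hEt
  · have : rieszEnergy μ p K L x y g = ∞ := by
      unfold rieszEnergy
      rw [← hEdef, hEt, ENNReal.mul_top]
      refine mul_ne_zero ?_ (ENNReal.rpow_pos (pos_iff_ne_zero.2 hd0) hdt).ne'
      simpa using hK0
    rw [this]; exact le_top
  set l₀ : ℝ≥0∞ := (E / edist x y) ^ (1 / p) with hl₀
  have hl₀p : l₀ ^ p = E / edist x y := by
    rw [hl₀, ← ENNReal.rpow_mul, one_div, inv_mul_cancel₀ hp0.ne', ENNReal.rpow_one]
  have hl₀t : l₀ ≠ ∞ := ENNReal.rpow_ne_top_of_nonneg (by positivity)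
    (ENNReal.div_lt_top hEt hd0).ne
  have key : ∀ n : ℕ, edist (u x) (u y) ^ p ≤
      (ENNReal.ofReal (K ^ (1 / p)) * (l₀ + ((n : ℝ≥0∞) + 1)⁻¹) * edist x y) ^ p := by
    intro n
    set l : ℝ≥0∞ := l₀ + ((n : ℝ≥0∞) + 1)⁻¹ with hl
    have hl0 : l ≠ 0 := by simp [hl]
    have hlt : l ≠ ∞ := by simp [hl, hl₀t]
    have hl₀l : l₀ < l := ENNReal.lt_add_right hl₀t (by simp)
    have hElt : E < l ^ p * edist x y := by
      calc E = l₀ ^ p * edist x y := by rw [hl₀p, ENNReal.div_mul_cancel hd0 hdt]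
        _ < _ := ENNReal.mul_lt_mul_left hd0 hdt (ENNReal.rpow_lt_rpow hl₀l hp0)
    -- Vitali–Carathéodory, with the room left by the strict inequality `E < l ^ p * edist x y`.
    obtain ⟨k, hgk, hk, hkE⟩ := exists_le_lowerSemicontinuous_lintegral_ge
      (rieszMeasure μ L x y) (fun z => g z ^ p) (hg.1.pow_const p) (tsub_pos_of_lt hElt).ne'
    rw [add_tsub_cancel_of_le hElt.le] at hkE
    set f : X → ℝ≥0∞ := fun z => k z ^ (1 / p) with hf
    have hflsc : LowerSemicontinuous f := by
      refine ENNReal.continuous_rpow_const.comp_lowerSemicontinuous hk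
        (ENNReal.monotone_rpow_of_nonneg (by positivity))
    have hfp : ∀ z, f z ^ p = k z := fun z => by
      rw [hf, ← ENNReal.rpow_mul, one_div, inv_mul_cancel₀ hp0.ne', ENNReal.rpow_one]
    have hgf : ∀ z, g z ≤ f z := fun z => by
      rw [← ENNReal.rpow_le_rpow_iff hp0, hfp]; exact hgk z
    obtain ⟨ℓ, γ, hℓ, hγ, hγ0, hγℓ, hint⟩ := hE.exists_curve_le h hCD hp hC hL hxy hflsc hl0 hlt
      (by simpa only [hfp] using hkE)
    have hrect := isRectifiableCurve_of_lipschitzOnWith hℓ hγ.lipschitzOnWith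
    refine ENNReal.rpow_le_rpow ?_ hp0.le
    calc edist (u x) (u y) = edist (u (γ ℓ)) (u (γ 0)) := by rw [hγ0, hγℓ, edist_comm]
      _ ≤ curveIntegral g γ 0 ℓ := hg.2 γ 0 ℓ hrect
      _ ≤ ∫⁻ s in Icc 0 ℓ, g (γ s) :=
        curveIntegral_le_of_lipschitzOnWith hℓ hγ.lipschitzOnWith g
      _ ≤ ∫⁻ s in Icc 0 ℓ, f (γ s) := lintegral_mono fun s => hgf _
      _ ≤ _ := hint
  have hlim : Tendsto (fun n : ℕ =>
      (ENNReal.ofReal (K ^ (1 / p)) * (l₀ + ((n : ℝ≥0∞) + 1)⁻¹) * edist x y) ^ p) atTop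
      (𝓝 ((ENNReal.ofReal (K ^ (1 / p)) * (l₀ + 0) * edist x y) ^ p)) := by
    refine (ENNReal.continuous_rpow_const.tendsto _).comp ?_
    refine ENNReal.Tendsto.mul_const ?_ (Or.inr hdt)
    refine ENNReal.Tendsto.const_mul ?_ (Or.inr ENNReal.ofReal_ne_top)
    refine tendsto_const_nhds.add ?_
    have := (tendsto_add_atTop_iff_nat 1).2 ENNReal.tendsto_inv_nat_nhds_zero
    simpa using this
  refine (ge_of_tendsto' hlim key).trans (le_of_eq ?_)
  unfold rieszEnergy
  rw [add_zero, ENNReal.mul_rpow_of_nonneg _ _ hp0.le, ENNReal.mul_rpow_of_nonneg _ _ hp0.le,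
    ENNReal.ofReal_rpow_of_nonneg (by positivity) hp0.le, ← Real.rpow_mul hK0.le, one_div,
    inv_mul_cancel₀ hp0.ne', Real.rpow_one, hl₀p, ← edist_rpow_sub_one_mul hxy, ← hEdef]
  calc _ = ENNReal.ofReal K * edist x y ^ (p - 1) * (E / edist x y * edist x y) := by ring
    _ = _ := by rw [ENNReal.div_mul_cancel hd0 hdt]

end CurveEstimate

end ChainPI

/-! ### The equivalences. -/

theorem mainTheorem7 (p : ℝ) (hp : 1 ≤ p) (CD : ℝ) (hCD : 1 ≤ CD) (C L : ℝ) (hC : 0 < C)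
    (hL : 1 ≤ L) :
    ∃ C' L' : ℝ, 0 < C' ∧ 1 ≤ L' ∧
      ∀ (X : Type*) [MetricSpace X] [TopologicalSpace.SeparableSpace X] [MeasurableSpace X]
        [BorelSpace X] (μ : Measure X), ChainPI.IsDoublingMetricMeasureSpace μ CD →
        ∀ x y : X,
          ((ChainPI.LipEstimate μ p x y C L ∨
              ChainPI.ChainConnectivity μ p x y C L ∨
              ChainPI.EpsUpperGradientEstimate μ p x y C L) →
            (ChainPI.LipEstimate μ p x y C' L' ∧
              ChainPI.ChainConnectivity μ p x y C' L' ∧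
              ChainPI.EpsUpperGradientEstimate μ p x y C' L')) ∧
          (CompleteSpace X →
            (ChainPI.LipEstimate μ p x y C L ∨
              ChainPI.ChainConnectivity μ p x y C L ∨
              ChainPI.EpsUpperGradientEstimate μ p x y C L ∨
              ChainPI.UpperGradientEstimate μ p x y C L) →
            (ChainPI.LipEstimate μ p x y C' L' ∧
              ChainPI.ChainConnectivity μ p x y C' L' ∧
              ChainPI.EpsUpperGradientEstimate μ p x y C' L' ∧
              ChainPI.UpperGradientEstimate μ p x y C' L')) := by
  have hp0 : 0 ≤ p := zero_le_one.trans hp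
  -- Every implication goes through `LipEstimate` with the original constants; `2 * L` is needed
  -- only for the averaging behind the chains.
  refine ⟨max C (max (ChainPI.chainConst p CD C L ^ p) (ChainPI.curveConst p CD C L)), 2 * L,
    lt_max_of_lt_left hC, by linarith, ?_⟩
  intro X _ _ _ _ μ h x y
  have := UniformSpace.secondCountable_of_separable X
  have hL2 : L ≤ 2 * L := by linarith
  have hlip : ChainPI.LipEstimate μ p x y C L ∨ ChainPI.ChainConnectivity μ p x y C L ∨
      ChainPI.EpsUpperGradientEstimate μ p x y C L → ChainPI.LipEstimate μ p x y C L := by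
    rintro (H | H | H)
    · exact H
    · exact (H.epsUpperGradientEstimate hp0).lipEstimate h hp hL
    · exact H.lipEstimate h hp hL
  have hchain : ChainPI.LipEstimate μ p x y C L → ChainPI.ChainConnectivity μ p x y
      (max C (max (ChainPI.chainConst p CD C L ^ p) (ChainPI.curveConst p CD C L))) (2 * L) :=
    fun H => (H.chainConnectivity h hCD hp hC hL).mono
      ((le_max_left _ _).trans (le_max_right _ _)) le_rfl
  refine ⟨fun H => ?_, fun hcomplete H => ?_⟩
  · have H' := hlip H
    exact ⟨H'.mono (le_max_left _ _) hL2, hchain H', (hchain H').epsUpperGradientEstimate hp0⟩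
  · have H' : ChainPI.LipEstimate μ p x y C L := by
      rcases H with H | H | H | H
      · exact H
      · exact hlip (Or.inr (Or.inl H))
      · exact hlip (Or.inr (Or.inr H))
      · exact H.lipEstimate
    exact ⟨H'.mono (le_max_left _ _) hL2, hchain H', (hchain H').epsUpperGradientEstimate hp0,
      (H'.upperGradientEstimate h hCD hp hC hL).mono
        ((le_max_right _ _).trans (le_max_right _ _)) hL2⟩
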